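/- Let $\Sigma=\{0,1\}$ be a two-letter alphabet and let $d\ge 1$. A parametrization of a hidden Markov process (HMP) on $d$ hidden states is a triple $\Theta=(M,E,\pi)$ of non-negative real arrays, $M\in\mathbb R^{d\times d}$, $E=(e_{ia})\in\mathbb R^{d\times\Sigma}$, $\pi\in\mathbb R^d$, such that the rows of $M$, the rows of $E$ and the vector $\pi$ have sum $1$; let $\mathcal H_{d,+}$ be the set of these triples. Without the non-negativity, the triples with these sums equal to $1$ form an affine space, which is identified with $\mathbb R^{d^2+d-1}$ by omitting the last column of $M$, the last column of $E$ and the last entry of $\pi$. For $a\in\Sigma$ put $T_a=\operatorname{diag}(e_{1a},\dots,e_{da})\,M$, and for $\Theta\in\mathbb R^{d^2+d-1}$ let $$\mathbf f_{n,d}(\Theta)=\bigl(\pi' T_{v_1}\cdots T_{v_n}\mathbf 1\bigr)_{v\in\Sigma^n}\in\mathbb R^{\Sigma^n},\qquad \mathbf 1=(1,\dots,1)'.$$ Theorem. There is a real algebraic variety $\mathcal N_d\subset\mathbb R^{d^2+d-1}$ with $\dim\mathcal N_d<d^2+d-1$ such that for every $n$ with $d\le\frac{n+1}{2}$ there is an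 algorithm $A$ which, given any probability distribution $\mathbf P:\Sigma^n\to[0,1]$ as input, outputs $$A(\mathbf P)=\begin{cases}\text{'HMP on $d$ hidden states'} & \text{if } \mathbf P\in\mathbf f_{n,d}(\mathcal H_{d,+}\setminus\mathcal N_d),\\ \text{'Cannot decide'} & \text{if } \mathbf P\in\mathbf f_{n,d}(\mathcal N_d),\\ \text{'No HMP on $d$ hidden states'} & \text{otherwise.}\end{cases}$$ (In particular the first two cases exclude each other.) In the first case $A$ also outputs a parametrization $\Theta\in\mathcal H_{d,+}\setminus\mathcal N_d$ with $\mathbf f_{n,d}(\Theta)=\mathbf P$, and it is unique up to permutation of the hidden states: every $\Theta'\in\mathbb R^{d^2+d-1}$ with $\mathbf f_{n,d}(\Theta')=\mathbf P$ arises from $\Theta$ by renumbering the hidden states. Here an algorithm is a finite computation tree with exact real arithmetic: it takes the $2^n$ numbers $\mathbf P(v)$ as input, may use rational constants, the operations $+,-,\times,/$ and the extraction of the $m$-th smallest real root of a univariate polynomial with computed coefficients, branches according to the sign of computed numbers, and at a leaf prints an answer, in the first case together with computed numbers. -/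

import Mathlib

/-! ### Hidden Markov parametrizations over the two-letter alphabet `Fin 2` -/

/-- A triple `(M, E, π)` with entries of type `R`: a `d × d` matrix `M` (transitions), a `d × 2`
matrix `E` (emissions, one column for each letter) and a vector `π` of length `d`. -/
structure HMPParam (d : ℕ) (R : Type) where
  M : Matrix (Fin d) (Fin d) R
  E : Matrix (Fin d) (Fin 2) R
  π : Fin d → R

namespace HMPParam

variable {d : ℕ} {R S : Type}

/-- Apply a function to all entries. -/
def map (g : R → S) (Θ : HMPParam d R) : HMPParam d S where
  M := fun i j => g (Θ.M i j)
  E := fun i a => g (Θ.E i a)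
  π := fun i => g (Θ.π i)

/-- Rename the hidden states by the permutation `σ`. -/
def permute (σ : Equiv.Perm (Fin d)) (Θ : HMPParam d R) : HMPParam d R where
  M := fun i j => Θ.M (σ i) (σ j)
  E := fun i a => Θ.E (σ i) a
  π := fun i => Θ.π (σ i)

/-- The rows of `M`, the rows of `E` and the vector `π` sum to one. -/
def Normalized (Θ : HMPParam d ℝ) : Prop :=
  (∀ i, ∑ j, Θ.M i j = 1) ∧ (∀ i, ∑ a, Θ.E i a = 1) ∧ ∑ i, Θ.π i = 1

/-- Normalized with non-negative entries: the parametrizations of hidden Markov processes. -/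
def Stochastic (Θ : HMPParam d ℝ) : Prop :=
  Θ.Normalized ∧ (∀ i j, 0 ≤ Θ.M i j) ∧ (∀ i a, 0 ≤ Θ.E i a) ∧ ∀ i, 0 ≤ Θ.π i

/-- `T a = O_a M` with `O_a = diag (e_{1a}, …, e_{da})`, that is `(T a) i j = e_{ia} m_{ij}`. -/
def T (Θ : HMPParam d ℝ) (a : Fin 2) : Matrix (Fin d) (Fin d) ℝ :=
  Matrix.diagonal (fun i => Θ.E i a) * Θ.M

/-- The map `f_{n,d}`: it sends `Θ` to `(π' T_{v_1} ⋯ T_{v_n} 𝟏)_v`, where `v` runs through the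
words of length `n`. -/
def law (n : ℕ) (Θ : HMPParam d ℝ) : (Fin n → Fin 2) → ℝ :=
  fun v => Θ.π ⬝ᵥ ((List.ofFn fun t => Θ.T (v t)).prod.mulVec fun _ => 1)

end HMPParam

/-- Indices for the free coordinates of a normalized triple `(M, E, π)`: the first `d - 1` columns
of `M`, the first column of `E` and the first `d - 1` entries of `π`. -/
abbrev ParamIdx (d : ℕ) : Type := (Fin d × Fin (d - 1)) ⊕ (Fin d ⊕ Fin (d - 1))

/-- The coordinates in `ℝ^(d² + d - 1)`. -/
def HMPParam.coords {d : ℕ} (Θ : HMPParam d ℝ) : ParamIdx d → ℝ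
  | .inl (i, j) => Θ.M i (Fin.castLE (Nat.sub_le d 1) j)
  | .inr (.inl i) => Θ.E i 0
  | .inr (.inr i) => Θ.π (Fin.castLE (Nat.sub_le d 1) i)

theorem card_paramIdx {d : ℕ} (hd : 1 ≤ d) : Fintype.card (ParamIdx d) = d ^ 2 + d - 1 := by
  obtain ⟨k, rfl⟩ : ∃ k, d = k + 1 := ⟨d - 1, by omega⟩
  simp only [Fintype.card_sum, Fintype.card_prod, Fintype.card_fin, Nat.add_sub_cancel]
  have h : (k + 1) ^ 2 = (k + 1) * k + (k + 1) := by ring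
  omega

/-- Normalized triples are identified with `ℝ^(d² + d - 1)` through their coordinates. -/
theorem coords_bijOn {d : ℕ} (hd : 1 ≤ d) :
    Set.BijOn (HMPParam.coords (d := d)) {Θ | Θ.Normalized} Set.univ := by
  obtain ⟨k, rfl⟩ : ∃ k, d = k + 1 := ⟨d - 1, by omega⟩
  have hc : ∀ j : Fin k, Fin.castLE (Nat.sub_le (k + 1) 1) j = Fin.castSucc j := fun _ => rfl
  refine ⟨fun _ _ => Set.mem_univ _, ?_, ?_⟩
  · rintro ⟨M, E, p⟩ ⟨h1, h2, h3⟩ ⟨M', E', p'⟩ ⟨h1', h2', h3'⟩ h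
    have hM : ∀ i (j : Fin k), M i j.castSucc = M' i j.castSucc := fun i j =>
      congrFun h (.inl (i, j))
    have hE : ∀ i, E i 0 = E' i 0 := fun i => congrFun h (.inr (.inl i))
    have hp : ∀ j : Fin k, p j.castSucc = p' j.castSucc := fun j => congrFun h (.inr (.inr j))
    simp only [Fin.sum_univ_two] at h2 h2'
    simp only [Fin.sum_univ_castSucc] at h1 h3 h1' h3'
    congr 1
    · ext i j
      refine Fin.lastCases ?_ (hM i) j
      have := Finset.sum_congr rfl fun j (_ : j ∈ Finset.univ) => hM i j
      linarith [h1 i, h1' i]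
    · ext i a
      fin_cases a
      · exact hE i
      · have := hE i
        simp only [Fin.mk_one]
        linarith [h2 i, h2' i]
    · ext i
      refine Fin.lastCases ?_ hp i
      have := Finset.sum_congr rfl fun j (_ : j ∈ Finset.univ) => hp j
      linarith
  · intro z _
    refine ⟨⟨fun i => Fin.snoc (α := fun _ => ℝ) (fun j : Fin k => z (.inl (i, j)))
        (1 - ∑ j : Fin k, z (.inl (i, j))),
      fun i => ![z (.inr (.inl i)), 1 - z (.inr (.inl i))],
      Fin.snoc (α := fun _ => ℝ) (fun j : Fin k => z (.inr (.inr j)))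
        (1 - ∑ j : Fin k, z (.inr (.inr j)))⟩, ⟨?_, ?_, ?_⟩, ?_⟩
    · intro i
      simp [Fin.sum_univ_castSucc]
    · intro i
      simp
    · simp [Fin.sum_univ_castSucc]
    · funext x
      rcases x with ⟨i, j⟩ | i | i
      · simp only [HMPParam.coords, hc, Fin.snoc_castSucc]
      · rfl
      · simp only [HMPParam.coords, hc, Fin.snoc_castSucc]

/-! ### Real algebraic varieties and their dimension -/

/-- `V ⊆ ℝ^ι` is the set of common real zeros of a set of real polynomials. -/
def IsRealVariety {ι : Type} (V : Set (ι → ℝ)) : Prop :=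
  ∃ I : Ideal (MvPolynomial ι ℝ), V = MvPolynomial.zeroLocus ℝ I

/-- The dimension of a variety `V ⊆ ℝ^ι`: the Krull dimension of its coordinate ring
`ℝ[X_ι] / I(V)`. It is `⊥` if `V` is empty. -/
noncomputable def realVarietyDim {ι : Type} (V : Set (ι → ℝ)) : WithBot ℕ∞ :=
  ringKrullDim (MvPolynomial ι ℝ ⧸ MvPolynomial.vanishingIdeal ℝ V)

/-! ### Algorithms with exact real arithmetic: finite algebraic computation trees -/

/-- Expressions that such an algorithm can evaluate: input numbers and rational constants, the four
arithmetic operations, and real roots of univariate polynomials (needed for eigenvalues). -/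
inductive RealExpr (ι : Type) : Type
  | input (i : ι) : RealExpr ι
  | const (q : ℚ) : RealExpr ι
  | add (s t : RealExpr ι) : RealExpr ι
  | sub (s t : RealExpr ι) : RealExpr ι
  | mul (s t : RealExpr ι) : RealExpr ι
  | div (s t : RealExpr ι) : RealExpr ι
  | root (k m : ℕ) (c : Fin (k + 1) → RealExpr ι) : RealExpr ι

/-- The `m`-th smallest (counting from `m = 0`) of the distinct real roots of
`c 0 + c 1 * X + ⋯ + c k * X ^ k`. It is `0` if this polynomial is zero or has no more than `m`
distinct real roots. -/
noncomputable def nthRealRoot {k : ℕ} (m : ℕ) (c : Fin (k + 1) → ℝ) : ℝ :=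
  ((∑ i : Fin (k + 1), Polynomial.C (c i) * Polynomial.X ^ (i : ℕ)).roots.toFinset.sort
    (· ≤ ·)).getD m 0

/-- The value of an expression on the input `x` (with the convention `r / 0 = 0`). -/
noncomputable def RealExpr.eval {ι : Type} (x : ι → ℝ) : RealExpr ι → ℝ
  | .input i => x i
  | .const q => (q : ℝ)
  | .add s t => s.eval x + t.eval x
  | .sub s t => s.eval x - t.eval x
  | .mul s t => s.eval x * t.eval x
  | .div s t => s.eval x / t.eval x
  | .root _ m c => nthRealRoot m fun i => (c i).eval x

/-- The possible answers; the first one comes with the parameters found. -/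
inductive Answer (X : Type) : Type
  | hmp (Θ : X) : Answer X
  | cannotDecide : Answer X
  | noHMP : Answer X

/-- A finite computation tree with inputs `(x i)_i`, that is, a terminating branching program: an
inner node evaluates an expression and branches according to the sign of its value; a leaf prints
an answer, in which the parameters are the values of given expressions. -/
inductive Routine (ι : Type) (d : ℕ) : Type
  | print (ans : Answer (HMPParam d (RealExpr ι))) : Routine ι d
  | branch (t : RealExpr ι) (ifNeg ifZero ifPos : Routine ι d) : Routine ι d

open Classical in
/-- The answer of a computation tree on the input `x`. -/
noncomputable def Routine.run {ι : Type} {d : ℕ} (x : ι → ℝ) :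
    Routine ι d → Answer (HMPParam d ℝ)
  | .print (.hmp Θ) => .hmp (Θ.map (RealExpr.eval x))
  | .print .cannotDecide => .cannotDecide
  | .print .noHMP => .noHMP
  | .branch t ifNeg ifZero ifPos =>
      if t.eval x < 0 then ifNeg.run x else if t.eval x = 0 then ifZero.run x else ifPos.run x

/-! Identifiability. Let A have the rows π' T_0^k and B the columns T_0^k 𝟏 for 0 ≤ k < d. The
entries of A B and A T_a B are probabilities of words of length at most 2d - 1 ≤ n, so the law
determines them; shorter words are sums of longer ones. The exceptional variety is the zero set of
det A · det B · det M times the Vandermonde determinant of the e_{i0}. If Θ lies off it and Θ' has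
the same law, then A' and B' are invertible, S = A⁻¹ A' satisfies S T_a' = T_a S, hence S M' = M S,
and cancelling M' shows that S intertwines the two emission diagonals. As S also fixes 𝟏 and the
e_{i0} are distinct, S is a permutation matrix (`eq_permute_of_law_eq`). In particular Θ' is
nondegenerate too, so the first two answers exclude each other.

Computability. Sorting the hidden states by e_{i0} makes the parametrization unique. By
Tarski-Seidenberg (`Semialgebraic.exists_sum`) the sets of laws in question, and the graph of each
entry of the sorted parametrization as a function of the law, are semialgebraic over ℚ. An isolated
point of a fibre is a root of one of finitely many polynomials with computable coefficients
(`exists_root_of_unique`), so a finite list of expressions contains each entry, and sign tests tell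
which member of the list is right. All decisions then depend on finitely many signs, and
`exists_routine_of_local` turns them into a tree.

Elimination of one variable rests on `Polynomial.exists_orderIso_of_sign_leadingCoeff`: in a finite
family closed under derivatives, removal of leading terms and pseudo-remainders, the signs of the
leading coefficients fix the whole sign table up to an order automorphism of the line. -/

section

open Set Filter Topology

/-! ### Functions on the line with matching signs -/

/-- A strictly increasing function on a finite set of reals extends to an order automorphism. -/
theorem exists_orderIso_extend (s : Finset ℝ) (u : ℝ → ℝ) :
    StrictMonoOn u s → ∃ φ : ℝ ≃o ℝ, ∀ x ∈ s, φ x = u x := by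
  induction s using Finset.induction_on_max with
  | empty => exact fun _ => ⟨OrderIso.refl ℝ, by simp⟩
  | insert a s ha ih =>
    intro hu
    obtain ⟨φ, hφ⟩ := ih (hu.mono (by simp))
    rcases s.eq_empty_or_nonempty with rfl | hs
    · exact ⟨OrderIso.addRight (u a - a), by simp⟩
    set m := s.max' hs with hm
    have hms : m ∈ s := s.max'_mem hs
    have hma : m < a := ha m hms
    have hc : 0 < (u a - u m) / (a - m) :=
      div_pos (sub_pos.2 (hu (by simp [hms]) (by simp) hma)) (sub_pos.2 hma)
    set c := (u a - u m) / (a - m) with hcdef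
    -- Beyond the old maximum `m`, `φ` is replaced by a ray whose slope `c` is chosen so that it
    -- passes through `(a, u a)`.
    let g : ℝ → ℝ := fun x => if x ≤ m then φ x else u m + c * (x - m)
    have hg1 : ∀ x, x ≤ m → g x = φ x := fun x hx => if_pos hx
    have hg2 : ∀ x, m < x → g x = u m + c * (x - m) := fun x hx => if_neg hx.not_ge
    have hmono : StrictMono g := by
      intro x y hxy
      rcases le_or_gt y m with hy | hy
      · rw [hg1 x (hxy.le.trans hy), hg1 y hy]
        exact φ.strictMono hxy
      rcases le_or_gt x m with hx | hx
      · rw [hg1 x hx, hg2 y hy]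
        have h1 : φ x ≤ u m := (φ.monotone hx).trans_eq (hφ m hms)
        have h2 : 0 < c * (y - m) := mul_pos hc (sub_pos.2 hy)
        linarith
      · rw [hg2 x hx, hg2 y hy]
        have : c * (x - m) < c * (y - m) := mul_lt_mul_of_pos_left (by linarith) hc
        linarith
    have hsurj : Function.Surjective g := by
      intro y
      rcases le_or_gt y (u m) with hy | hy
      · refine ⟨φ.symm y, ?_⟩
        rw [hg1 _ ?_, φ.apply_symm_apply]
        rwa [φ.symm_apply_le, hφ m hms]
      · have : 0 < (y - u m) / c := div_pos (sub_pos.2 hy) hc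
        refine ⟨m + (y - u m) / c, ?_⟩
        rw [hg2 _ (by linarith)]
        field_simp
        ring
    refine ⟨hmono.orderIsoOfSurjective g hsurj, fun x hx => ?_⟩
    rw [StrictMono.coe_orderIsoOfSurjective]
    rcases Finset.mem_insert.1 hx with rfl | hx
    · rw [hg2 _ hma, hcdef, div_mul_cancel₀ _ (sub_ne_zero.2 hma.ne')]
      ring
    · rw [hg1 _ (s.le_max' x hx), hφ x hx]

/-- The finite set `Z` cuts the line into pieces on which `f` is injective, and the outer pieces
contain no zeros of `f`. -/
structure Adapted (f : ℝ → ℝ) (Z : Finset ℝ) : Prop where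
  cont : Continuous f
  rolle : ∀ x y, x < y → f x = f y → ∃ z ∈ Z, x < z ∧ z < y
  lower : ∃ b ∈ Z, f b ≠ 0 ∧ ∀ x ≤ b, SignType.sign (f x) = SignType.sign (f b)
  upper : ∃ b ∈ Z, f b ≠ 0 ∧ ∀ x, b ≤ x → SignType.sign (f x) = SignType.sign (f b)

namespace Adapted

variable {f g : ℝ → ℝ} {Z : Finset ℝ}

theorem neg (h : Adapted f Z) : Adapted (-f) Z where
  cont := h.cont.neg
  rolle x y hxy he := h.rolle x y hxy (neg_injective he)
  lower := by
    obtain ⟨b, hb, h0, h1⟩ := h.lower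
    exact ⟨b, hb, by simpa using h0, fun x hx => by simp [Left.sign_neg, h1 x hx]⟩
  upper := by
    obtain ⟨b, hb, h0, h1⟩ := h.upper
    exact ⟨b, hb, by simpa using h0, fun x hx => by simp [Left.sign_neg, h1 x hx]⟩

/-- A point between two points of `Z` but not in `Z` lies between two consecutive points of `Z`,
and `f` is strictly monotone between these. -/
theorem exists_cell (h : Adapted f Z) {x : ℝ} (hx : x ∉ Z) (hl : ∃ z ∈ Z, z ≤ x)
    (hu : ∃ z ∈ Z, x ≤ z) :
    ∃ a ∈ Z, ∃ b ∈ Z, a < x ∧ x < b ∧ (∀ z ∈ Z, z ≤ a ∨ b ≤ z) ∧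
      (StrictMonoOn f (Icc a b) ∨ StrictAntiOn f (Icc a b)) := by
  have ne : ∀ z ∈ Z, z ≠ x := fun z hz e => hx (e ▸ hz)
  have hl' : (Z.filter (· < x)).Nonempty := by
    obtain ⟨z, hz, hzx⟩ := hl
    exact ⟨z, Finset.mem_filter.2 ⟨hz, lt_of_le_of_ne hzx (ne z hz)⟩⟩
  have hu' : (Z.filter (x < ·)).Nonempty := by
    obtain ⟨z, hz, hzx⟩ := hu
    exact ⟨z, Finset.mem_filter.2 ⟨hz, lt_of_le_of_ne hzx (ne z hz).symm⟩⟩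
  obtain ⟨haZ, hax⟩ := Finset.mem_filter.1 (Finset.max'_mem _ hl')
  obtain ⟨hbZ, hxb⟩ := Finset.mem_filter.1 (Finset.min'_mem _ hu')
  set a := (Z.filter (· < x)).max' hl'
  set b := (Z.filter (x < ·)).min' hu'
  have hgap : ∀ z ∈ Z, z ≤ a ∨ b ≤ z := by
    intro z hz
    rcases lt_or_gt_of_ne (ne z hz) with hzx | hzx
    · exact .inl (Finset.le_max' _ _ (Finset.mem_filter.2 ⟨hz, hzx⟩))
    · exact .inr (Finset.min'_le _ _ (Finset.mem_filter.2 ⟨hz, hzx⟩))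
  refine ⟨a, haZ, b, hbZ, hax, hxb, hgap, ?_⟩
  refine h.cont.continuousOn.strictMonoOn_of_injOn_Icc' (hax.trans hxb).le ?_
  -- Equal values inside the cell would produce a point of `Z` strictly between `a` and `b`.
  have key : ∀ s ∈ Icc a b, ∀ t ∈ Icc a b, s < t → f s ≠ f t := by
    intro s hs t ht hst he
    obtain ⟨z, hz, h1, h2⟩ := h.rolle s t hst he
    rcases hgap z hz with h3 | h3
    · exact absurd (hs.1.trans_lt h1) h3.not_gt
    · exact absurd (h2.trans_le ht.2) h3.not_gt
  intro s hs t ht he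
  by_contra hne
  rcases lt_or_gt_of_ne hne with hlt | hlt
  · exact key s hs t ht hlt he
  · exact key t ht s hs hlt he.symm

theorem lower_le (h : Adapted f Z) {x : ℝ} (hx : f x = 0) : ∃ z ∈ Z, z ≤ x := by
  obtain ⟨b, hb, h0, h1⟩ := h.lower
  refine ⟨b, hb, le_of_not_ge fun hxb => h0 ?_⟩
  have := h1 x hxb
  rw [hx, sign_zero] at this
  exact sign_eq_zero_iff.1 this.symm

theorem le_upper (h : Adapted f Z) {x : ℝ} (hx : f x = 0) : ∃ z ∈ Z, x ≤ z := by
  obtain ⟨b, hb, h0, h1⟩ := h.upper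
  refine ⟨b, hb, le_of_not_ge fun hxb => h0 ?_⟩
  have := h1 x hxb
  rw [hx, sign_zero] at this
  exact sign_eq_zero_iff.1 this.symm

/-- Corresponding cells of `f` and `g` contain corresponding zeros. -/
theorem exists_root (h : Adapted f Z) (hg : Continuous g) (φ : ℝ ≃o ℝ)
    (hs : ∀ z ∈ Z, SignType.sign (f z) = SignType.sign (g (φ z))) {w : ℝ} (hw : f w = 0) :
    ∃ w', g w' = 0 ∧ ∀ z ∈ Z, (z < w ↔ φ z < w') ∧ (w < z ↔ w' < φ z) := by
  by_cases hwZ : w ∈ Z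
  · refine ⟨φ w, ?_, fun z _ => by simp⟩
    have := hs w hwZ
    rw [hw, sign_zero] at this
    exact sign_eq_zero_iff.1 this.symm
  obtain ⟨a, ha, b, hb, haw, hwb, hgap, hmono⟩ := h.exists_cell hwZ (h.lower_le hw) (h.le_upper hw)
  have hab := haw.trans hwb
  -- Strict monotonicity gives `f` opposite signs at the ends of the cell; these signs carry over to
  -- `g`, which therefore has a zero between `φ a` and `φ b`.
  have h0 : (0 : ℝ) ∈ g '' Ioo (φ a) (φ b) := by
    have hφ : φ a ≤ φ b := φ.monotone hab.le
    rcases hmono with hm | hm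
    · have h1 : f a < 0 := hw ▸ hm ⟨le_rfl, hab.le⟩ ⟨haw.le, hwb.le⟩ haw
      have h2 : 0 < f b := hw ▸ hm ⟨haw.le, hwb.le⟩ ⟨hab.le, le_rfl⟩ hwb
      have h3 : g (φ a) < 0 := sign_eq_neg_one_iff.1 (hs a ha ▸ sign_neg h1)
      have h4 : 0 < g (φ b) := sign_eq_one_iff.1 (hs b hb ▸ sign_pos h2)
      exact intermediate_value_Ioo hφ hg.continuousOn ⟨h3, h4⟩
    · have h1 : 0 < f a := hw ▸ hm ⟨le_rfl, hab.le⟩ ⟨haw.le, hwb.le⟩ haw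
      have h2 : f b < 0 := hw ▸ hm ⟨haw.le, hwb.le⟩ ⟨hab.le, le_rfl⟩ hwb
      have h3 : 0 < g (φ a) := sign_eq_one_iff.1 (hs a ha ▸ sign_pos h1)
      have h4 : g (φ b) < 0 := sign_eq_neg_one_iff.1 (hs b hb ▸ sign_neg h2)
      exact intermediate_value_Ioo' hφ hg.continuousOn ⟨h4, h3⟩
  obtain ⟨w', ⟨h1, h2⟩, h3⟩ := h0
  refine ⟨w', h3, fun z hz => ?_⟩
  rcases hgap z hz with hz' | hz'
  · have h4 : z < w := hz'.trans_lt haw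
    have h5 : φ z < w' := (φ.monotone hz').trans_lt h1
    exact ⟨⟨fun _ => h5, fun _ => h4⟩, ⟨fun h => absurd h h4.not_gt, fun h => absurd h h5.not_gt⟩⟩
  · have h4 : w < z := hwb.trans_le hz'
    have h5 : w' < φ z := h2.trans_le (φ.monotone hz')
    exact ⟨⟨fun h => absurd h h4.not_gt, fun h => absurd h h5.not_gt⟩, ⟨fun _ => h5, fun _ => h4⟩⟩

/-- From a point where `f` is positive one reaches `Z` without meeting a zero of `f`. -/
theorem exists_pos_segment (h : Adapted f Z) {x : ℝ} (hx : 0 < f x) :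
    ∃ z ∈ Z, ∀ t ∈ uIcc x z, 0 < f t := by
  by_cases hxZ : x ∈ Z
  · exact ⟨x, hxZ, fun t ht => by simp at ht; rwa [ht]⟩
  obtain ⟨b, hb, -, hb1⟩ := h.lower
  obtain ⟨c, hc, -, hc1⟩ := h.upper
  rcases le_total x b with hxb | hbx
  · refine ⟨b, hb, fun t ht => ?_⟩
    rw [uIcc_of_le hxb] at ht
    rw [← sign_eq_one_iff, hb1 t ht.2, ← hb1 x hxb, sign_eq_one_iff]
    exact hx
  rcases le_total c x with hxc | hcx
  · refine ⟨c, hc, fun t ht => ?_⟩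
    rw [uIcc_of_ge hxc] at ht
    rw [← sign_eq_one_iff, hc1 t ht.1, ← hc1 x hxc, sign_eq_one_iff]
    exact hx
  obtain ⟨a, ha, b, hb, hax, hxb, -, hmono⟩ := h.exists_cell hxZ ⟨b, hb, hbx⟩ ⟨c, hc, hcx⟩
  rcases hmono with hm | hm
  · refine ⟨b, hb, fun t ht => hx.trans_le ?_⟩
    rw [uIcc_of_le hxb.le] at ht
    exact hm.monotoneOn ⟨hax.le, hxb.le⟩ ⟨hax.le.trans ht.1, ht.2⟩ ht.1
  · refine ⟨a, ha, fun t ht => hx.trans_le ?_⟩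
    rw [uIcc_of_ge hax.le] at ht
    exact hm.antitoneOn ⟨ht.1, ht.2.trans hxb.le⟩ ⟨hax.le, hxb.le⟩ ht.2

/-- From `x` there is a segment to `Z` on which `f` stays positive. At its end `g ∘ ψ` is positive
as well, and a change of sign on the way would create a zero of `g ∘ ψ` that is not a zero of `f`.
-/
theorem pos_of_roots (h : Adapted f Z) (hg : Continuous g) (ψ : ℝ ≃o ℝ)
    (hs : ∀ z ∈ Z, SignType.sign (f z) = SignType.sign (g (ψ z)))
    (hr : ∀ x, g (ψ x) = 0 → f x = 0) {x : ℝ} (hx : 0 < f x) : 0 < g (ψ x) := by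
  obtain ⟨z, hz, hpos⟩ := h.exists_pos_segment hx
  have h1 : 0 < g (ψ z) := sign_eq_one_iff.1 (hs z hz ▸ sign_pos (hpos z right_mem_uIcc))
  by_contra hneg
  have h2 : (0 : ℝ) ∈ uIcc (g (ψ x)) (g (ψ z)) := by
    rw [mem_uIcc]
    exact .inl ⟨not_lt.1 hneg, h1.le⟩
  obtain ⟨t, ht, ht0⟩ := intermediate_value_uIcc
    (hg.comp ψ.continuous).continuousOn (a := x) (b := z) h2
  exact (hpos t ht).ne' (hr t ht0)

/-- If the signs of `f` and `g` agree at corresponding points of adapted sets, then they agree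
everywhere after a change of variable. -/
theorem exists_orderIso_sign_eq (h : Adapted f Z) (φ : ℝ ≃o ℝ)
    (h' : Adapted g (Z.image φ))
    (hs : ∀ z ∈ Z, SignType.sign (f z) = SignType.sign (g (φ z))) :
    ∃ ψ : ℝ ≃o ℝ, (∀ z ∈ Z, ψ z = φ z) ∧
      ∀ x, SignType.sign (f x) = SignType.sign (g (ψ x)) := by
  have hE : ∀ w, ∃ w', f w = 0 →
      g w' = 0 ∧ ∀ z ∈ Z, (z < w ↔ φ z < w') ∧ (w < z ↔ w' < φ z) := fun w => by
    by_cases hw : f w = 0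
    · obtain ⟨w', hw'⟩ := h.exists_root h'.cont φ hs hw
      exact ⟨w', fun _ => hw'⟩
    · exact ⟨0, fun h => absurd h hw⟩
  choose u hu using hE
  have hE' : ∀ w', g w' = 0 → ∃ w, f w = 0 ∧ ∀ z ∈ Z, (z < w ↔ φ z < w') ∧ (w < z ↔ w' < φ z) := by
    intro w' hw'
    obtain ⟨w, hw, hw1⟩ := h'.exists_root h.cont φ.symm (by simpa using fun z hz => (hs z hz).symm) hw'
    refine ⟨w, hw, fun z hz => ?_⟩
    have := hw1 (φ z) (Finset.mem_image_of_mem _ hz)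
    simp only [OrderIso.symm_apply_apply] at this
    exact ⟨this.1.symm, this.2.symm⟩
  -- Pigeonhole: `Z.card + 2` zeros would be separated by `Z.card + 1` distinct points of `Z`.
  have hfin : {x | f x = 0}.Finite := by
    by_contra hinf
    obtain ⟨t, ht, hcard⟩ := Set.Infinite.exists_subset_card_eq hinf (Z.card + 2)
    have hstep : ∀ i : Fin (Z.card + 1), ∃ z ∈ Z,
        t.orderEmbOfFin hcard i.castSucc < z ∧ z < t.orderEmbOfFin hcard i.succ := by
      intro i
      refine h.rolle _ _ ((t.orderEmbOfFin hcard).strictMono i.castSucc_lt_succ) ?_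
      rw [show f _ = 0 from ht (t.orderEmbOfFin_mem hcard _),
        show f _ = 0 from ht (t.orderEmbOfFin_mem hcard _)]
    choose v hvZ hv1 hv2 using hstep
    have hvm : StrictMono v := fun i j hij => by
      refine (hv2 i).trans_le (le_trans ?_ (hv1 j).le)
      exact (t.orderEmbOfFin hcard).monotone (Fin.le_def.2 (by simpa using hij))
    have := Finset.card_le_card_of_injOn (s := Finset.univ) (t := Z) v (fun i _ => hvZ i)
      hvm.injective.injOn
    simp at this
  -- The prescribed values of the new change of variable: `φ` on `Z`, and the matching zero of `g`
  -- at the other zeros of `f`. They increase because two zeros of `f` are always separated by a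
  -- point of `Z`.
  let u' : ℝ → ℝ := fun x => if x ∈ Z then φ x else u x
  have hu1 : ∀ z ∈ Z, u' z = φ z := fun z hz => if_pos hz
  have hu2 : ∀ w, f w = 0 → g (u' w) = 0 ∧
      ∀ z ∈ Z, (z < w ↔ φ z < u' w) ∧ (w < z ↔ u' w < φ z) := by
    intro w hw
    by_cases hwZ : w ∈ Z
    · rw [hu1 w hwZ]
      refine ⟨?_, fun z _ => by simp⟩
      have := hs w hwZ
      rw [hw, sign_zero] at this
      exact sign_eq_zero_iff.1 this.symm
    · rw [show u' w = u w from if_neg hwZ]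
      exact hu w hw
  have hmono : StrictMonoOn u' ((Z ∪ hfin.toFinset : Finset ℝ) : Set ℝ) := by
    intro x hx y hy hxy
    simp only [Finset.coe_union, Finite.coe_toFinset, mem_union, Finset.mem_coe,
      mem_ofPred_eq] at hx hy
    rcases hx with hx | hx
    · rcases hy with hy | hy
      · rw [hu1 x hx, hu1 y hy]
        exact φ.strictMono hxy
      · rw [hu1 x hx]
        exact ((hu2 y hy).2 x hx).1.1 hxy
    · rcases hy with hy | hy
      · rw [hu1 y hy]
        exact ((hu2 x hx).2 y hy).2.1 hxy
      · obtain ⟨z, hz, h1, h2⟩ := h.rolle x y hxy (hx.trans hy.symm)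
        exact (((hu2 x hx).2 z hz).2.1 h1).trans (((hu2 y hy).2 z hz).1.1 h2)
  obtain ⟨ψ, hψ⟩ := exists_orderIso_extend _ u' hmono
  have hψZ : ∀ z ∈ Z, ψ z = φ z := fun z hz => by
    rw [hψ z (Finset.mem_union_left _ hz), hu1 z hz]
  have hψr : ∀ w, f w = 0 → ψ w = u' w := fun w hw =>
    hψ w (Finset.mem_union_right _ (by simpa using hw))
  -- No further zeros of `g` appear: `ψ x` matches some zero `w` of `f`, so `ψ x` and `u' w` are
  -- zeros of `g` in the same position relative to the image of `Z`, and the separation property of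
  -- `g` makes them equal.
  have hr : ∀ x, g (ψ x) = 0 → f x = 0 := by
    intro x hx
    obtain ⟨w, hw, hcut⟩ := hE' _ hx
    have hcut' := (hu2 w hw).2
    rcases lt_trichotomy (u' w) (ψ x) with hlt | heq | hlt
    · obtain ⟨z, hz, h1, h2⟩ := h'.rolle _ _ hlt ((hu2 w hw).1.trans hx.symm)
      obtain ⟨z, hzZ, rfl⟩ := Finset.mem_image.1 hz
      have h3 := ((hcut z hzZ).1.2 h2)
      exact absurd ((hcut' z hzZ).1.1 h3) h1.not_gt
    · rw [← hψr w hw] at heq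
      rwa [← ψ.injective heq]
    · obtain ⟨z, hz, h1, h2⟩ := h'.rolle _ _ hlt (hx.trans (hu2 w hw).1.symm)
      obtain ⟨z, hzZ, rfl⟩ := Finset.mem_image.1 hz
      have h3 := ((hcut z hzZ).2.2 h1)
      exact absurd ((hcut' z hzZ).2.1 h3) h2.not_gt
  have hs' : ∀ z ∈ Z, SignType.sign (f z) = SignType.sign (g (ψ z)) := fun z hz => by
    rw [hψZ z hz, hs z hz]
  refine ⟨ψ, hψZ, fun x => ?_⟩
  rcases lt_trichotomy (f x) 0 with hx | hx | hx
  · have := h.neg.pos_of_roots (g := -g) h'.cont.neg ψ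
      (fun z hz => by simp [Left.sign_neg, hs' z hz]) (fun x hx => by simpa using hr x (by simpa using hx))
      (x := x) (by simpa using hx)
    rw [sign_neg hx, sign_neg (by simpa using this)]
  · rw [hx, hψr x hx, (hu2 x hx).1]
  · rw [sign_pos hx, sign_pos (h.pos_of_roots h'.cont ψ hs' hr hx)]

end Adapted

end

section

open Set Filter Topology

namespace Polynomial

/-! ### Signs of real polynomials -/

theorem eventually_sign_atTop (p : ℝ[X]) :
    ∀ᶠ x in atTop, SignType.sign (p.eval x) = SignType.sign p.leadingCoeff := by
  have pos : ∀ q : ℝ[X], 0 < q.leadingCoeff → ∀ᶠ x in atTop, 0 < q.eval x := by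
    intro q hq
    rcases le_or_gt q.degree 0 with hd | hd
    · rw [eq_C_of_degree_le_zero hd] at hq ⊢
      exact Eventually.of_forall fun x => by simpa using hq
    · exact (tendsto_atTop_of_leadingCoeff_nonneg q hd hq.le).eventually_gt_atTop 0
  rcases lt_trichotomy p.leadingCoeff 0 with h | h | h
  · filter_upwards [pos (-p) (by simpa using h)] with x hx
    rw [sign_neg h, sign_neg (by simpa using hx)]
  · rw [leadingCoeff_eq_zero] at h
    simp [h]
  · filter_upwards [pos p h] with x hx
    rw [sign_pos h, sign_pos hx]

theorem eventually_sign_atBot (p : ℝ[X]) :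
    ∀ᶠ x in atBot, SignType.sign (p.eval x) =
      SignType.sign ((-1) ^ p.natDegree * p.leadingCoeff) := by
  have h := tendsto_neg_atBot_atTop.eventually (eventually_sign_atTop (p.comp (-X)))
  filter_upwards [h] with x hx
  simpa using hx

/-! ### Pseudo-division -/

section Ring

variable {R : Type*} [CommRing R]

/-- Multiplying by the leading coefficient of `g` replaces division by it, so the usual cancellation
of top terms works over any commutative ring. Here the coefficients will be polynomials in the
remaining variables. -/
theorem exists_pseudo_division (f g : R[X]) (hg : 0 < g.natDegree) :
    ∃ (k : ℕ) (q r : R[X]), C g.leadingCoeff ^ k * f = q * g + r ∧ r.natDegree < g.natDegree := by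
  induction hn : f.natDegree using Nat.strong_induction_on generalizing f with
  | _ n ih =>
    rcases lt_or_ge f.natDegree g.natDegree with hlt | hge
    · exact ⟨0, 0, f, by simp, hlt⟩
    set f₁ := C g.leadingCoeff * f - C f.leadingCoeff * X ^ (f.natDegree - g.natDegree) * g
      with hf₁
    have hle : f₁.natDegree ≤ f.natDegree := by
      refine (natDegree_sub_le _ _).trans (max_le (natDegree_C_mul_le _ _) ?_)
      refine natDegree_mul_le.trans ?_
      have := natDegree_C_mul_X_pow_le f.leadingCoeff (f.natDegree - g.natDegree)
      omega
    have hcoeff : f₁.coeff f.natDegree = 0 := by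
      have h1 : (X ^ (f.natDegree - g.natDegree) * g).coeff f.natDegree = g.leadingCoeff := by
        conv_lhs => rw [← Nat.sub_add_cancel hge]
        rw [Nat.add_comm, coeff_X_pow_mul' ]
        simp
      rw [hf₁, coeff_sub, coeff_C_mul, mul_assoc, coeff_C_mul, h1, coeff_natDegree, mul_comm,
        sub_self]
    have hlt : f₁.natDegree < f.natDegree := by
      refine lt_of_le_of_ne hle fun he => ?_
      have : f₁ = 0 := by rw [← leadingCoeff_eq_zero, leadingCoeff, he, hcoeff]
      rw [this, natDegree_zero] at he
      omega
    obtain ⟨k, q, r, h, hr⟩ := ih _ (hn ▸ hlt) f₁ rfl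
    refine ⟨k + 1, q + C g.leadingCoeff ^ k * (C f.leadingCoeff * X ^ (f.natDegree - g.natDegree)),
      r, ?_, hr⟩
    rw [hf₁] at h
    linear_combination h

open Classical in
/-- A remainder of `f` in the pseudo-division by `g`. -/
noncomputable def pseudoRem (f g : R[X]) : R[X] :=
  if hg : 0 < g.natDegree then (exists_pseudo_division f g hg).choose_spec.choose_spec.choose else 0

theorem pseudoRem_spec (f : R[X]) {g : R[X]} (hg : 0 < g.natDegree) :
    (∃ (k : ℕ) (q : R[X]), C g.leadingCoeff ^ k * f = q * g + pseudoRem f g) ∧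
      (pseudoRem f g).natDegree < g.natDegree := by
  have h := (exists_pseudo_division f g hg).choose_spec.choose_spec.choose_spec
  rw [pseudoRem, dif_pos hg]
  exact ⟨⟨_, _, h.1⟩, h.2⟩

/-- `D` is closed under derivatives, removal of the leading term and pseudo-division, for
polynomials of degree at least `n`. -/
def ClosedFrom (n : ℕ) (D : Finset R[X]) : Prop :=
  ∀ f ∈ D, n ≤ f.natDegree → derivative f ∈ D ∧ f.eraseLead ∈ D ∧
    ∀ g ∈ D, n ≤ g.natDegree → g.natDegree ≤ f.natDegree → pseudoRem f g ∈ D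

theorem natDegree_eraseLead_lt {f : R[X]} (hf : 0 < f.natDegree) :
    f.eraseLead.natDegree < f.natDegree :=
  (eraseLead_natDegree_le f).trans_lt (by omega)

theorem natDegree_derivative_lt_of_pos {f : R[X]} (hf : 0 < f.natDegree) :
    (derivative f).natDegree < f.natDegree :=
  natDegree_derivative_lt hf.ne'

/-- Closure is achieved degree by degree from the top. Treating degree `n` adds only polynomials of
degree below `n`, so nothing already arranged in degrees at least `n` is disturbed, and the family
stays finite. -/
theorem exists_closedFrom_one (F : Finset R[X]) : ∃ D, F ⊆ D ∧ ClosedFrom 1 D := by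
  classical
  have step : ∀ n, 1 ≤ n → (∃ D, F ⊆ D ∧ ClosedFrom (n + 1) D) → ∃ D, F ⊆ D ∧ ClosedFrom n D := by
    rintro n hn ⟨D, hFD, hD⟩
    let B := D.filter fun g => g.natDegree = n
    let D' := D ∪ (B.image derivative ∪ (B.image eraseLead ∪ Finset.image₂ pseudoRem D B))
    have hsub : D ⊆ D' := Finset.subset_union_left
    have hlow : ∀ f ∈ D', n ≤ f.natDegree → f ∈ D := by
      intro f hf hnf
      by_contra hfD
      refine absurd hnf (not_le.2 ?_)
      simp only [D', B, Finset.mem_union, Finset.mem_image, Finset.mem_filter,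
        Finset.mem_image₂] at hf
      rcases hf with hf | ⟨g, ⟨-, rfl⟩, rfl⟩ | ⟨g, ⟨-, rfl⟩, rfl⟩ | ⟨h, -, g, ⟨-, rfl⟩, rfl⟩
      · exact absurd hf hfD
      · exact natDegree_derivative_lt_of_pos hn
      · exact natDegree_eraseLead_lt hn
      · exact (pseudoRem_spec h hn).2
    refine ⟨D', hFD.trans hsub, fun f hf hnf => ?_⟩
    have hfD := hlow f hf hnf
    have hderiv : derivative f ∈ D' ∧ f.eraseLead ∈ D' := by
      rcases hnf.eq_or_lt with he | hlt
      · have hfB : f ∈ B := Finset.mem_filter.2 ⟨hfD, he.symm⟩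
        simp only [D', Finset.mem_union]
        exact ⟨.inr (.inl (Finset.mem_image_of_mem _ hfB)),
          .inr (.inr (.inl (Finset.mem_image_of_mem _ hfB)))⟩
      · exact ⟨hsub (hD f hfD hlt).1, hsub (hD f hfD hlt).2.1⟩
    refine ⟨hderiv.1, hderiv.2, fun g hg hng hgf => ?_⟩
    have hgD := hlow g hg hng
    rcases hng.eq_or_lt with he | hlt
    · have hgB : g ∈ B := Finset.mem_filter.2 ⟨hgD, he.symm⟩
      simp only [D', Finset.mem_union]
      exact .inr (.inr (.inr (Finset.mem_image₂_of_mem hfD hgB)))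
    · exact hsub ((hD f hfD (hlt.trans_le hgf)).2.2 g hgD hlt hgf)
  -- Above the maximal degree the closure condition is vacuous.
  have top : ∃ D, F ⊆ D ∧ ClosedFrom (F.sup natDegree + 1) D :=
    ⟨F, Finset.Subset.refl _, fun f hf h => absurd (Finset.le_sup (f := natDegree) hf) (by omega)⟩
  have all : ∀ m, (∃ D, F ⊆ D ∧ ClosedFrom (m + 1) D) → ∃ D, F ⊆ D ∧ ClosedFrom 1 D := by
    intro m
    induction m with
    | zero => exact id
    | succ m ih => exact fun h => ih (step (m + 1) (by omega) h)
  exact all _ top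

theorem map_eq_map_eraseLead {S : Type*} [CommRing S] (y : R →+* S) {f : R[X]}
    (h : y f.leadingCoeff = 0) : f.map y = f.eraseLead.map y := by
  have e := congrArg (map y) (eraseLead_add_C_mul_X_pow f)
  rw [← e, Polynomial.map_add, Polynomial.map_mul, map_C, h, map_zero, zero_mul, add_zero]

/-- If a polynomial with a zero at `z` is found in a closed family, then there is one whose leading
coefficient does not vanish. -/
theorem exists_leadingCoeff_ne_zero {s : Finset R[X]} (hs : ClosedFrom 1 s) (y : R →+* ℝ) {z : ℝ}
    {g : R[X]} (hg : g ∈ s) (h0 : g.map y ≠ 0) (hz : (g.map y).eval z = 0) :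
    ∃ h ∈ s, y h.leadingCoeff ≠ 0 ∧ (h.map y).eval z = 0 ∧ 0 < h.natDegree := by
  induction hn : g.natDegree using Nat.strong_induction_on generalizing g with
  | _ n ih =>
    have hpos : 0 < g.natDegree := by
      by_contra hd
      rw [eq_C_of_natDegree_eq_zero (by omega : g.natDegree = 0)] at h0 hz
      simp only [map_C, eval_C] at hz
      simp [hz] at h0
    by_cases hl : y g.leadingCoeff = 0
    · rw [map_eq_map_eraseLead y hl] at h0 hz
      exact ih _ (hn ▸ natDegree_eraseLead_lt hpos) (hs g hg hpos).2.1 h0 hz rfl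
    · exact ⟨g, hg, hl, hz, hpos⟩

theorem map_eq_zero_of_sign_eq {y y' : R →+* ℝ} {φ : ℝ ≃o ℝ} {g : R[X]}
    (h : ∀ x, SignType.sign ((g.map y).eval x) = SignType.sign ((g.map y').eval (φ x)))
    (h0 : g.map y = 0) : g.map y' = 0 := by
  refine Polynomial.funext fun x => ?_
  have := h (φ.symm x)
  rw [h0, eval_zero, sign_zero, φ.apply_symm_apply] at this
  rw [sign_eq_zero_iff.1 this.symm, eval_zero]

end Ring

/-! ### Sign tables of closed families -/

theorem sign_eq_of_no_root (p : ℝ[X]) {x y : ℝ} (h : ∀ t ∈ uIcc x y, p.eval t ≠ 0) :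
    SignType.sign (p.eval x) = SignType.sign (p.eval y) := by
  by_contra hne
  have hx := h x left_mem_uIcc
  have hy := h y right_mem_uIcc
  have h0 : (0 : ℝ) ∈ uIcc (p.eval x) (p.eval y) := by
    rw [mem_uIcc]
    rcases lt_or_gt_of_ne hx with h1 | h1 <;> rcases lt_or_gt_of_ne hy with h2 | h2
    · exact absurd (by rw [sign_neg h1, sign_neg h2]) hne
    · exact .inl ⟨h1.le, h2.le⟩
    · exact .inr ⟨h2.le, h1.le⟩
    · exact absurd (by rw [sign_pos h1, sign_pos h2]) hne
  obtain ⟨t, ht, ht0⟩ := intermediate_value_uIcc p.continuous.continuousOn h0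
  exact h t ht ht0

/-- A nonconstant real polynomial is adapted to each finite set that contains the zeros of its
derivative and a point on either side of all its zeros. -/
theorem adapted {p : ℝ[X]} (hp : 0 < p.natDegree) {Z : Finset ℝ}
    (hZ : ∀ x, (derivative p).eval x = 0 → x ∈ Z)
    {b c : ℝ} (hb : b ∈ Z) (hc : c ∈ Z)
    (hb' : ∀ x ≤ b, SignType.sign (p.eval x) = SignType.sign ((-1) ^ p.natDegree * p.leadingCoeff))
    (hc' : ∀ x, c ≤ x → SignType.sign (p.eval x) = SignType.sign p.leadingCoeff) :
    Adapted (fun x => p.eval x) Z where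
  cont := p.continuous
  rolle x y hxy he := by
    obtain ⟨z, hz, hz0⟩ := exists_deriv_eq_zero hxy p.continuous.continuousOn he
    rw [Polynomial.deriv] at hz0
    exact ⟨z, hZ z hz0, hz.1, hz.2⟩
  lower := by
    have hl : p.leadingCoeff ≠ 0 := leadingCoeff_ne_zero.2 (ne_zero_of_natDegree_gt hp)
    refine ⟨b, hb, fun h => ?_, fun x hx => by rw [hb' x hx, hb' b le_rfl]⟩
    have := hb' b le_rfl
    rw [h, sign_zero, eq_comm, sign_eq_zero_iff] at this
    simp [hl] at this
  upper := by
    have hl : p.leadingCoeff ≠ 0 := leadingCoeff_ne_zero.2 (ne_zero_of_natDegree_gt hp)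
    refine ⟨c, hc, fun h => ?_, fun x hx => by rw [hc' x hx, hc' c le_rfl]⟩
    have := hc' c le_rfl
    rw [h, sign_zero, eq_comm, sign_eq_zero_iff] at this
    exact hl this

variable {R : Type*} [CommRing R]

/-- In a family of polynomials that is closed under derivatives and pseudo-division, the signs of
the leading coefficients determine the sign table of the family, up to a change of variable. -/
theorem exists_orderIso_of_sign_leadingCoeff (y y' : R →+* ℝ) (D : Finset R[X]) :
    ClosedFrom 1 D →
    (∀ f ∈ D, SignType.sign (y f.leadingCoeff) = SignType.sign (y' f.leadingCoeff)) →
    ∃ φ : ℝ ≃o ℝ, ∀ f ∈ D, ∀ x,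
      SignType.sign ((f.map y).eval x) = SignType.sign ((f.map y').eval (φ x)) := by
  classical
  refine Finset.induction_on_max_value (fun f : R[X] => f.natDegree) D
    (fun _ _ => ⟨OrderIso.refl ℝ, by simp⟩) ?_
  · intro a s has hmax ih hD hsign
    have hmem : ∀ f ∈ insert a s, f.natDegree < a.natDegree → f ∈ s := by
      intro f hf hlt
      rcases Finset.mem_insert.1 hf with rfl | hf
      · exact absurd hlt (lt_irrefl _)
      · exact hf
    -- Polynomials are inserted in order of degree. What closure demands of members of `s` has
    -- degree smaller than that of `a`, hence is never `a` itself.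
    have hs : ClosedFrom 1 s := by
      intro f hf hpos
      obtain ⟨h1, h2, h3⟩ := hD f (Finset.mem_insert_of_mem hf) hpos
      have hfa := hmax f hf
      refine ⟨hmem _ h1 ((natDegree_derivative_lt_of_pos hpos).trans_le hfa),
        hmem _ h2 ((natDegree_eraseLead_lt hpos).trans_le hfa), fun g hg hg1 hgf => ?_⟩
      exact hmem _ (h3 g (Finset.mem_insert_of_mem hg) hg1 hgf)
        ((pseudoRem_spec f hg1).2.trans_le (hgf.trans hfa))
    obtain ⟨φ, hφ⟩ := ih hs fun f hf => hsign f (Finset.mem_insert_of_mem hf)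
    have hlc := hsign a (Finset.mem_insert_self _ _)
    suffices H : ∃ ψ : ℝ ≃o ℝ,
        (∀ x, SignType.sign ((a.map y).eval x) = SignType.sign ((a.map y').eval (ψ x))) ∧
        ∀ f ∈ s, ∀ x,
          SignType.sign ((f.map y).eval x) = SignType.sign ((f.map y').eval (ψ x)) by
      obtain ⟨ψ, h1, h2⟩ := H
      refine ⟨ψ, fun f hf => ?_⟩
      rcases Finset.mem_insert.1 hf with rfl | hf
      exacts [h1, h2 f hf]
    rcases Nat.eq_zero_or_pos a.natDegree with hd | hd
    · refine ⟨φ, fun x => ?_, hφ⟩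
      rw [leadingCoeff, hd] at hlc
      rw [eq_C_of_natDegree_eq_zero hd]
      simpa using hlc
    obtain ⟨ha1, ha2, ha3⟩ := hD a (Finset.mem_insert_self _ _) hd
    replace ha1 := hmem _ ha1 (natDegree_derivative_lt_of_pos hd)
    replace ha2 := hmem _ ha2 (natDegree_eraseLead_lt hd)
    -- If the leading coefficient specializes to zero, `a` has the same specialization as its
    -- truncation, which already belongs to `s`.
    by_cases hl : y a.leadingCoeff = 0
    · have hl' : y' a.leadingCoeff = 0 := by
        rw [hl, sign_zero, eq_comm, sign_eq_zero_iff] at hlc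
        exact hlc
      refine ⟨φ, fun x => ?_, hφ⟩
      rw [map_eq_map_eraseLead y hl, map_eq_map_eraseLead y' hl']
      exact hφ _ ha2 x
    have hl' : y' a.leadingCoeff ≠ 0 := by
      rwa [← sign_ne_zero, ← hlc, sign_ne_zero]
    have hdeg := natDegree_map_of_leadingCoeff_ne_zero y hl
    have hdeg' := natDegree_map_of_leadingCoeff_ne_zero y' hl'
    have hlead := leadingCoeff_map_of_leadingCoeff_ne_zero y hl
    have hlead' := leadingCoeff_map_of_leadingCoeff_ne_zero y' hl'
    have hbot := eventually_sign_atBot (a.map y)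
    have hbot' := φ.tendsto_atBot.eventually (eventually_sign_atBot (a.map y'))
    have htop := eventually_sign_atTop (a.map y)
    have htop' := φ.tendsto_atTop.eventually (eventually_sign_atTop (a.map y'))
    -- `b` and `c` are taken so far out that both specializations of `a`, the second one read
    -- through `φ`, have their limiting signs beyond them.
    obtain ⟨b, hb⟩ := eventually_atBot.1 (hbot.and hbot')
    obtain ⟨c, hc⟩ := eventually_atTop.1 (htop.and htop')
    let Z₀ : Finset ℝ := s.biUnion fun g => (g.map y).roots.toFinset
    have hZ₀ : ∀ z, z ∈ Z₀ ↔ ∃ g ∈ s, g.map y ≠ 0 ∧ (g.map y).eval z = 0 := by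
      intro z
      simp [Z₀, mem_roots']
    let Z : Finset ℝ := insert b (insert c Z₀)
    have hbZ : b ∈ Z := Finset.mem_insert_self _ _
    have hcZ : c ∈ Z := Finset.mem_insert_of_mem (Finset.mem_insert_self _ _)
    have hZ₀Z : ∀ z ∈ Z₀, z ∈ Z := fun z hz =>
      Finset.mem_insert_of_mem (Finset.mem_insert_of_mem hz)
    have hderiv : derivative (a.map y) ≠ 0 := fun h => by
      have := derivative_eq_zero.1 h
      omega
    have hderiv' : derivative (a.map y') ≠ 0 := fun h => by
      have := derivative_eq_zero.1 h
      omega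
    have hA : Adapted (fun x => (a.map y).eval x) Z := by
      refine adapted (hdeg ▸ hd) (fun x hx => hZ₀Z x ((hZ₀ x).2 ⟨_, ha1, ?_⟩)) hbZ hcZ
        (fun x hx => (hb x hx).1) (fun x hx => (hc x hx).1)
      rw [← derivative_map]
      exact ⟨hderiv, hx⟩
    have hA' : Adapted (fun x => (a.map y').eval x) (Z.image φ) := by
      refine adapted (hdeg' ▸ hd) (fun x hx => ?_) (Finset.mem_image_of_mem φ hbZ)
        (Finset.mem_image_of_mem φ hcZ) (fun x hx => ?_) (fun x hx => ?_)
      · refine Finset.mem_image.2 ⟨φ.symm x, hZ₀Z _ ((hZ₀ _).2 ⟨_, ha1, ?_, ?_⟩), by simp⟩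
        · rwa [← derivative_map]
        · have := hφ _ ha1 (φ.symm x)
          rw [φ.apply_symm_apply, ← derivative_map, ← derivative_map, hx, sign_zero,
            sign_eq_zero_iff] at this
          rwa [← derivative_map]
      · simpa using (hb (φ.symm x) (by simpa [φ.symm_apply_le] using hx)).2
      · simpa using (hc (φ.symm x) (by simpa [φ.le_symm_apply] using hx)).2
    have hsZ : ∀ z ∈ Z, SignType.sign ((a.map y).eval z) = SignType.sign ((a.map y').eval (φ z)) := by
      intro z hz
      rcases Finset.mem_insert.1 hz with rfl | hz
      · rw [(hb z le_rfl).1, (hb z le_rfl).2, hdeg, hdeg', hlead, hlead', sign_mul, sign_mul, hlc]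
      rcases Finset.mem_insert.1 hz with rfl | hz
      · rw [(hc z le_rfl).1, (hc z le_rfl).2, hlead, hlead', hlc]
      -- At a zero `z` of a smaller polynomial, some `h` in `s` vanishes with nonvanishing leading
      -- coefficient. There a power of that coefficient times `a` equals the pseudo-remainder, so
      -- the sign of `a` is read off from `s`.
      obtain ⟨g, hg, hg0, hgz⟩ := (hZ₀ z).1 hz
      obtain ⟨h, hh, hhl, hhz, hhd⟩ := exists_leadingCoeff_ne_zero hs y hg hg0 hgz
      obtain ⟨⟨k, q, hkq⟩, hrd⟩ := pseudoRem_spec a hhd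
      have hr : pseudoRem a h ∈ s := hmem _ (ha3 h (Finset.mem_insert_of_mem hh) hhd (hmax h hh))
        (hrd.trans_le (hmax h hh))
      have hhl' := hsign h (Finset.mem_insert_of_mem hh)
      have hhz' : (h.map y').eval (φ z) = 0 := by
        have := hφ h hh z
        rw [hhz, sign_zero, eq_comm, sign_eq_zero_iff] at this
        exact this
      have e1 := congrArg (fun p => (p.map y).eval z) hkq
      have e2 := congrArg (fun p => (p.map y').eval (φ z)) hkq
      simp only [Polynomial.map_mul, Polynomial.map_pow, Polynomial.map_add, map_C, eval_mul,
        eval_pow, eval_add, eval_C, hhz, hhz', mul_zero, zero_add] at e1 e2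
      have e3 := hφ _ hr z
      rw [← e1, ← e2, sign_mul, sign_mul, sign_pow, sign_pow, ← hhl'] at e3
      exact mul_left_cancel₀ (pow_ne_zero _ (sign_ne_zero.2 hhl)) e3
    obtain ⟨ψ, hψ, hψa⟩ := hA.exists_orderIso_sign_eq φ hA' hsZ
    refine ⟨ψ, hψa, fun g hg x => ?_⟩
    by_cases hg0 : g.map y = 0
    · rw [hg0, map_eq_zero_of_sign_eq (hφ g hg) hg0]
      simp
    -- Passing from `φ` to `ψ` keeps the signs of `s`: a zero of `g` between `x` and `φ.symm (ψ x)`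
    -- would lie in `Z`, where `φ` and `ψ` agree, and monotonicity would force the two points to
    -- coincide.
    rw [show ψ x = φ (φ.symm (ψ x)) by simp, ← hφ g hg]
    set x₁ := φ.symm (ψ x) with hx₁
    by_cases hx : x = x₁
    · rw [← hx]
    refine sign_eq_of_no_root _ fun t ht ht0 => hx ?_
    have htψ : ψ t = φ t := hψ t (hZ₀Z t ((hZ₀ t).2 ⟨g, hg, hg0, ht0⟩))
    have hφx : φ x₁ = ψ x := by simp [hx₁]
    rcases mem_uIcc.1 ht with ⟨h1, h2⟩ | ⟨h1, h2⟩
    · have h3 : ψ x ≤ ψ t := ψ.monotone h1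
      have h4 : φ t ≤ φ x₁ := φ.monotone h2
      have h5 : ψ x = ψ t := le_antisymm h3 (by rw [htψ, ← hφx]; exact h4)
      have h6 : φ x₁ = φ t := by rw [hφx, h5, htψ]
      rw [ψ.injective h5, φ.injective h6]
    · have h3 : ψ t ≤ ψ x := ψ.monotone h2
      have h4 : φ x₁ ≤ φ t := φ.monotone h1
      have h5 : ψ x = ψ t := le_antisymm (by rw [htψ, ← hφx]; exact h4) h3
      have h6 : φ x₁ = φ t := by rw [hφx, h5, htψ]
      rw [ψ.injective h5, φ.injective h6]

end Polynomial

end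

section

open Set Filter Topology

/-! ### Semialgebraic sets -/

section Semialgebraic

variable {σ τ : Type}

/-- The polynomials in `C` have the same signs at `y` and at `y'`. -/
def SignEq (C : Finset (MvPolynomial σ ℚ)) (y y' : σ → ℝ) : Prop :=
  ∀ c ∈ C, SignType.sign (MvPolynomial.aeval y c) = SignType.sign (MvPolynomial.aeval y' c)

theorem SignEq.mono {C D : Finset (MvPolynomial σ ℚ)} (h : C ⊆ D) {y y' : σ → ℝ}
    (hy : SignEq D y y') : SignEq C y y' :=
  fun c hc => hy c (h hc)

/-- Membership in `s` depends only on the signs of finitely many polynomials with rational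
coefficients. -/
def Semialgebraic (s : Set (σ → ℝ)) : Prop :=
  ∃ C : Finset (MvPolynomial σ ℚ), ∀ y y', SignEq C y y' → y ∈ s → y' ∈ s

theorem Semialgebraic.inter {s t : Set (σ → ℝ)} (hs : Semialgebraic s) (ht : Semialgebraic t) :
    Semialgebraic (s ∩ t) := by
  classical
  obtain ⟨C, hC⟩ := hs
  obtain ⟨D, hD⟩ := ht
  exact ⟨C ∪ D, fun y y' h hy => ⟨hC y y' (h.mono Finset.subset_union_left) hy.1,
    hD y y' (h.mono Finset.subset_union_right) hy.2⟩⟩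

theorem Semialgebraic.iInter {ι : Type*} [Finite ι] {s : ι → Set (σ → ℝ)}
    (hs : ∀ i, Semialgebraic (s i)) : Semialgebraic (⋂ i, s i) := by
  classical
  cases nonempty_fintype ι
  choose C hC using hs
  refine ⟨Finset.univ.biUnion C, fun y y' h hy => mem_iInter.2 fun i => ?_⟩
  exact hC i y y' (h.mono (Finset.subset_biUnion_of_mem C (Finset.mem_univ i)))
    (mem_iInter.1 hy i)

theorem Semialgebraic.preimage_comp {s : Set (σ → ℝ)} (hs : Semialgebraic s) (f : σ → τ) :
    Semialgebraic {y : τ → ℝ | y ∘ f ∈ s} := by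
  classical
  obtain ⟨C, hC⟩ := hs
  refine ⟨C.image (MvPolynomial.rename f), fun y y' h => hC _ _ fun c hc => ?_⟩
  simpa [MvPolynomial.aeval_rename] using h _ (Finset.mem_image_of_mem _ hc)

/-- Singling out the variable `none` turns signs at a point into signs of univariate polynomials
whose coefficients are evaluated at the remaining coordinates. -/
theorem aeval_option_elim (y : σ → ℝ) (x : ℝ) (c : MvPolynomial (Option σ) ℚ) :
    MvPolynomial.aeval (fun o : Option σ => o.elim x y) c =
      ((MvPolynomial.optionEquivLeft ℚ σ c).map
        (MvPolynomial.aeval y : MvPolynomial σ ℚ →ₐ[ℚ] ℝ).toRingHom).eval x := by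
  induction c using MvPolynomial.induction_on with
  | C a => simp [MvPolynomial.optionEquivLeft_C]
  | add p q hp hq => simp [hp, hq]
  | mul_X p o hp =>
    cases o with
    | none => simp [hp, MvPolynomial.optionEquivLeft_X_none]
    | some i => simp [hp, MvPolynomial.optionEquivLeft_X_some]

/-- The projection of a semialgebraic set along one coordinate is semialgebraic. -/
theorem Semialgebraic.exists_option {s : Set (Option σ → ℝ)} (hs : Semialgebraic s) :
    Semialgebraic {y : σ → ℝ | ∃ x : ℝ, (fun o : Option σ => o.elim x y) ∈ s} := by
  classical
  obtain ⟨C, hC⟩ := hs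
  obtain ⟨D, hCD, hD⟩ :=
    Polynomial.exists_closedFrom_one (C.image (MvPolynomial.optionEquivLeft ℚ σ))
  refine ⟨D.image Polynomial.leadingCoeff, ?_⟩
  rintro y y' h ⟨x, hx⟩
  obtain ⟨φ, hφ⟩ := Polynomial.exists_orderIso_of_sign_leadingCoeff
    (MvPolynomial.aeval y : MvPolynomial σ ℚ →ₐ[ℚ] ℝ).toRingHom
    (MvPolynomial.aeval y' : MvPolynomial σ ℚ →ₐ[ℚ] ℝ).toRingHom D hD
    fun f hf => h _ (Finset.mem_image_of_mem _ hf)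
  refine ⟨φ x, hC _ _ (fun c hc => ?_) hx⟩
  rw [aeval_option_elim, aeval_option_elim]
  exact hφ _ (hCD (Finset.mem_image_of_mem _ hc)) x

/-- The Tarski-Seidenberg theorem: projections of semialgebraic sets are semialgebraic. -/
theorem Semialgebraic.exists_sum [Finite τ] :
    ∀ {s : Set (σ ⊕ τ → ℝ)}, Semialgebraic s →
      Semialgebraic {y : σ → ℝ | ∃ t : τ → ℝ, Sum.elim y t ∈ s} := by
  induction τ using Finite.induction_empty_option with
  | of_equiv e ih =>
    intro s hs
    convert ih (hs.preimage_comp (Sum.map id e.symm)) using 1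
    ext y
    have hy : ∀ t, Sum.elim y t = Sum.elim y (t ∘ e) ∘ Sum.map id e.symm := fun t => by
      ext (i | i) <;> simp
    constructor
    · rintro ⟨t, ht⟩
      refine ⟨t ∘ e, ?_⟩
      rwa [mem_ofPred_eq, ← hy]
    · rintro ⟨t, ht⟩
      refine ⟨t ∘ e.symm, ?_⟩
      rw [hy]
      simpa [Function.comp_assoc] using ht
  | h_empty =>
    intro s hs
    convert hs.preimage_comp (Sum.elim id PEmpty.elim) using 1
    ext y
    have e : ∀ t : PEmpty → ℝ, Sum.elim y t = y ∘ Sum.elim id PEmpty.elim := fun t => by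
      ext (i | i)
      · rfl
      · exact i.elim
    constructor
    · rintro ⟨t, ht⟩
      rwa [mem_ofPred_eq, ← e t]
    · intro h
      exact ⟨PEmpty.elim, by rw [e]; exact h⟩
  | @h_option τ _ ih =>
    intro s hs
    convert ih (hs.preimage_comp (τ := Option (σ ⊕ τ))
      (Sum.elim (fun i => some (.inl i)) fun o => o.elim none fun j => some (.inr j))).exists_option
      using 1
    ext y
    have e : ∀ (x : ℝ) (t : τ → ℝ), Sum.elim y (fun o : Option τ => o.elim x t) =
        (fun o : Option (σ ⊕ τ) => o.elim x (Sum.elim y t)) ∘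
          (Sum.elim (fun i => some (.inl i)) fun o => o.elim none fun j => some (.inr j)) :=
      fun x t => by ext (i | _ | i) <;> rfl
    constructor
    · rintro ⟨t, ht⟩
      refine ⟨t ∘ some, t none, ?_⟩
      rw [mem_ofPred_eq, ← e]
      convert ht using 2
      ext (_ | i) <;> rfl
    · rintro ⟨t, x, hx⟩
      exact ⟨fun o => o.elim x t, by rw [e]; exact hx⟩

/-- A point that is isolated in its fibre of a semialgebraic set is a root of one of the defining
polynomials. -/
theorem exists_root_of_unique {s : Set (Option σ → ℝ)} {C : Finset (MvPolynomial (Option σ) ℚ)}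
    (hC : ∀ y y', SignEq C y y' → y ∈ s → y' ∈ s) {y : σ → ℝ} {t : ℝ}
    (ht : (fun o : Option σ => o.elim t y) ∈ s)
    (huniq : ∀ t', (fun o : Option σ => o.elim t' y) ∈ s → t' = t) :
    ∃ c ∈ C, t ∈ ((MvPolynomial.optionEquivLeft ℚ σ c).map
        (MvPolynomial.aeval y : MvPolynomial σ ℚ →ₐ[ℚ] ℝ).toRingHom).roots := by
  by_contra! hcon
  -- Away from the roots all signs are locally constant, and a polynomial that specializes to zero
  -- has sign zero everywhere. Points near `t` would then lie in the fibre too.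
  have hev : ∀ᶠ x in 𝓝 t,
      SignEq C (fun o : Option σ => o.elim t y) (fun o : Option σ => o.elim x y) := by
    refine (Filter.eventually_all_finset C).2 fun c hc => ?_
    simp only [aeval_option_elim]
    set p := (MvPolynomial.optionEquivLeft ℚ σ c).map
        (MvPolynomial.aeval y : MvPolynomial σ ℚ →ₐ[ℚ] ℝ).toRingHom with hp
    by_cases hp0 : p = 0
    · simp [hp0]
    have hpt : p.eval t ≠ 0 := fun h => hcon c hc ((Polynomial.mem_roots hp0).2 h)
    rcases lt_or_gt_of_ne hpt with h | h
    · filter_upwards [p.continuous.continuousAt.eventually (gt_mem_nhds h)] with x hx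
      rw [sign_neg h, sign_neg hx]
    · filter_upwards [p.continuous.continuousAt.eventually (lt_mem_nhds h)] with x hx
      rw [sign_pos h, sign_pos hx]
  obtain ⟨x, hx, hxt⟩ := ((hev.filter_mono nhdsWithin_le_nhds).and
    (self_mem_nhdsWithin (a := t) (s := {t}ᶜ))).exists
  exact hxt (huniq x (hC _ _ hx ht))

/-! ### Polynomial functions with rational coefficients -/

/-- `g` is given by a polynomial with rational coefficients. -/
def IsRatPoly (g : (σ → ℝ) → ℝ) : Prop :=
  ∃ p : MvPolynomial σ ℚ, ∀ y, MvPolynomial.aeval y p = g y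

theorem IsRatPoly.coord (i : σ) : IsRatPoly fun y => y i :=
  ⟨MvPolynomial.X i, by simp⟩

theorem IsRatPoly.const (q : ℚ) : IsRatPoly fun _ : σ → ℝ => (q : ℝ) :=
  ⟨MvPolynomial.C q, by simp⟩

theorem IsRatPoly.zero : IsRatPoly fun _ : σ → ℝ => (0 : ℝ) := by
  simpa using IsRatPoly.const (σ := σ) 0

theorem IsRatPoly.one : IsRatPoly fun _ : σ → ℝ => (1 : ℝ) := by
  simpa using IsRatPoly.const (σ := σ) 1

variable {f g : (σ → ℝ) → ℝ}

theorem IsRatPoly.mul (hf : IsRatPoly f) (hg : IsRatPoly g) : IsRatPoly fun y => f y * g y := by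
  obtain ⟨p, hp⟩ := hf
  obtain ⟨q, hq⟩ := hg
  exact ⟨p * q, by simp [hp, hq]⟩

theorem IsRatPoly.sub (hf : IsRatPoly f) (hg : IsRatPoly g) : IsRatPoly fun y => f y - g y := by
  obtain ⟨p, hp⟩ := hf
  obtain ⟨q, hq⟩ := hg
  exact ⟨p - q, by simp [hp, hq]⟩

theorem IsRatPoly.sum {ι : Type*} (s : Finset ι) {f : ι → (σ → ℝ) → ℝ}
    (hf : ∀ i, IsRatPoly (f i)) : IsRatPoly fun y => ∑ i ∈ s, f i y := by
  choose p hp using hf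
  exact ⟨∑ i ∈ s, p i, by simp [hp]⟩

theorem IsRatPoly.prod {ι : Type*} (s : Finset ι) {f : ι → (σ → ℝ) → ℝ}
    (hf : ∀ i, IsRatPoly (f i)) : IsRatPoly fun y => ∏ i ∈ s, f i y := by
  choose p hp using hf
  exact ⟨∏ i ∈ s, p i, by simp [hp]⟩

theorem IsRatPoly.det {n : ℕ} {A : (σ → ℝ) → Matrix (Fin n) (Fin n) ℝ}
    (hA : ∀ i j, IsRatPoly fun y => A y i j) : IsRatPoly fun y => (A y).det := by
  simp only [Matrix.det_apply']
  refine .sum _ fun e => ?_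
  have := IsRatPoly.const (σ := σ) (Equiv.Perm.sign e : ℤ)
  simp only [Rat.cast_intCast] at this
  exact this.mul (.prod _ fun i => hA _ _)

theorem IsRatPoly.matrix_mul {n : ℕ} {A B : (σ → ℝ) → Matrix (Fin n) (Fin n) ℝ}
    (hA : ∀ i j, IsRatPoly fun y => A y i j) (hB : ∀ i j, IsRatPoly fun y => B y i j) (i j : Fin n) :
    IsRatPoly fun y => (A y * B y) i j := by
  simp only [Matrix.mul_apply]
  exact .sum _ fun k => (hA i k).mul (hB k j)

theorem IsRatPoly.matrix_one {n : ℕ} (i j : Fin n) :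
    IsRatPoly fun _ : σ → ℝ => (1 : Matrix (Fin n) (Fin n) ℝ) i j := by
  rcases eq_or_ne i j with rfl | h
  · simpa using IsRatPoly.one
  · simpa [h] using IsRatPoly.zero

theorem IsRatPoly.list_prod {n : ℕ} {α : Type*} {A : α → (σ → ℝ) → Matrix (Fin n) (Fin n) ℝ}
    (hA : ∀ a i j, IsRatPoly fun y => A a y i j) (l : List α) (i j : Fin n) :
    IsRatPoly fun y => (l.map fun a => A a y).prod i j := by
  induction l generalizing i j with
  | nil => simpa using IsRatPoly.matrix_one i j
  | cons a l ih =>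
    simp only [List.map_cons, List.prod_cons]
    exact IsRatPoly.matrix_mul (hA a) ih i j

theorem IsRatPoly.semialgebraic_sign (hg : IsRatPoly g) (S : Set SignType) :
    Semialgebraic {y | SignType.sign (g y) ∈ S} := by
  obtain ⟨p, hp⟩ := hg
  refine ⟨{p}, fun y y' h hy => ?_⟩
  have := h p (Finset.mem_singleton_self p)
  rw [hp, hp] at this
  rwa [mem_ofPred_eq, ← this]

theorem IsRatPoly.semialgebraic_eq (hf : IsRatPoly f) (hg : IsRatPoly g) :
    Semialgebraic {y | f y = g y} := by
  convert (hf.sub hg).semialgebraic_sign {0} using 1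
  ext y
  simp [sub_eq_zero, sign_eq_zero_iff]

theorem IsRatPoly.semialgebraic_ne (hf : IsRatPoly f) (hg : IsRatPoly g) :
    Semialgebraic {y | f y ≠ g y} := by
  convert (hf.sub hg).semialgebraic_sign {0}ᶜ using 1
  ext y
  simp [sub_eq_zero, sign_eq_zero_iff]

theorem IsRatPoly.semialgebraic_lt (hf : IsRatPoly f) (hg : IsRatPoly g) :
    Semialgebraic {y | f y < g y} := by
  convert (hg.sub hf).semialgebraic_sign {1} using 1
  ext y
  simp [sign_eq_one_iff]

theorem IsRatPoly.semialgebraic_le (hf : IsRatPoly f) (hg : IsRatPoly g) :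
    Semialgebraic {y | f y ≤ g y} := by
  convert (hf.sub hg).semialgebraic_sign {1}ᶜ using 1
  ext y
  simp [sign_eq_one_iff]

end Semialgebraic

end

section

open Matrix

/-! ### Dimension of hypersurfaces -/

/-- A proper real hypersurface has smaller dimension than the ambient space. -/
theorem realVarietyDim_lt {ι : Type} [Finite ι] {V : Set (ι → ℝ)} {p : MvPolynomial ι ℝ}
    (hp : p ≠ 0) (hV : ∀ z ∈ V, MvPolynomial.aeval z p = 0) :
    realVarietyDim V < ((Nat.card ι : ℕ) : WithBot ℕ∞) := by
  have h := ringKrullDim_succ_le_of_surjective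
    (Ideal.Quotient.mk (MvPolynomial.vanishingIdeal ℝ V)) Ideal.Quotient.mk_surjective
    (mem_nonZeroDivisors_of_ne_zero hp) (Ideal.Quotient.eq_zero_iff_mem.2
      (MvPolynomial.mem_vanishingIdeal_iff.2 hV))
  rw [MvPolynomial.ringKrullDim_of_isNoetherianRing, ringKrullDim_eq_zero_of_field, zero_add] at h
  rw [realVarietyDim]
  generalize ringKrullDim (MvPolynomial ι ℝ ⧸ MvPolynomial.vanishingIdeal ℝ V) = x at h ⊢
  induction x using WithBot.recBotCoe with
  -- The value `⊥` is that of the empty set.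
  | bot => exact WithBot.bot_lt_coe _
  | coe x =>
    have h' : x + 1 ≤ (Nat.card ι : ℕ∞) := by exact_mod_cast h
    have : x < (Nat.card ι : ℕ∞) := (ENat.add_one_le_iff' (ENat.natCast_ne_top _)).1 h'
    exact_mod_cast this

namespace HMPParam

variable {d : ℕ}

/-! ### Probabilities of words -/

/-- The probability `π' T_{w_1} ⋯ T_{w_k} 𝟏` of the word `w`. -/
def word (Θ : HMPParam d ℝ) (w : List (Fin 2)) : ℝ :=
  Θ.π ⬝ᵥ ((w.map Θ.T).prod *ᵥ fun _ => 1)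

theorem law_eq_word (n : ℕ) (Θ : HMPParam d ℝ) (v : Fin n → Fin 2) :
    Θ.law n v = Θ.word (List.ofFn v) := by
  simp [law, word, List.map_ofFn, Function.comp_def]

theorem T_apply (Θ : HMPParam d ℝ) (a : Fin 2) (i j : Fin d) :
    Θ.T a i j = Θ.E i a * Θ.M i j :=
  diagonal_mul _ _ _ _

theorem Normalized.T_add_T {Θ : HMPParam d ℝ} (h : Θ.Normalized) : Θ.T 0 + Θ.T 1 = Θ.M := by
  ext i j
  have := h.2.1 i
  rw [Fin.sum_univ_two] at this
  rw [Matrix.add_apply, T_apply, T_apply, ← add_mul, this, one_mul]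

theorem Normalized.M_mulVec_one {Θ : HMPParam d ℝ} (h : Θ.Normalized) :
    (Θ.M *ᵥ fun _ => 1) = fun _ => 1 := by
  ext i
  simpa [mulVec, dotProduct] using h.1 i

/-- Summing over the last letter gives T_0 + T_1 = M, and M fixes 𝟏. Only the normalization enters,
not non-negativity. -/
theorem Normalized.word_append {Θ : HMPParam d ℝ} (h : Θ.Normalized) (w : List (Fin 2)) :
    Θ.word w = Θ.word (w ++ [0]) + Θ.word (w ++ [1]) := by
  simp only [word, List.map_append, List.prod_append, List.map_cons, List.map_nil,
    List.prod_cons, List.prod_nil, mul_one, ← mulVec_mulVec]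
  rw [← dotProduct_add, ← mulVec_add, ← add_mulVec, h.T_add_T, h.M_mulVec_one]

/-- Normalized parametrizations with the same law on words of length `n` have the same
probabilities of shorter words. -/
theorem word_eq_of_law_eq {n : ℕ} {Θ Θ' : HMPParam d ℝ} (h : Θ.Normalized) (h' : Θ'.Normalized)
    (hlaw : Θ'.law n = Θ.law n) {w : List (Fin 2)} (hw : w.length ≤ n) : Θ'.word w = Θ.word w := by
  induction hk : n - w.length generalizing w with
  | zero =>
    have hlen : w.length = n := by omega
    subst hlen
    have := congrFun hlaw w.get
    rwa [law_eq_word, law_eq_word, List.ofFn_get] at this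
  | succ k ih =>
    rw [h.word_append, h'.word_append, ih (w := w ++ [0]), ih (w := w ++ [1])] <;>
      simp <;> omega

/-! ### Nondegenerate parametrizations -/

/-- The matrix with rows `π' T_0 ^ k`. -/
def rowMatrix (Θ : HMPParam d ℝ) : Matrix (Fin d) (Fin d) ℝ :=
  of fun k => Θ.π ᵥ* (Θ.T 0 ^ (k : ℕ))

/-- The matrix with columns `T_0 ^ k 𝟏`. -/
def colMatrix (Θ : HMPParam d ℝ) : Matrix (Fin d) (Fin d) ℝ :=
  of fun i k => ((Θ.T 0 ^ (k : ℕ)) *ᵥ fun _ => 1) i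

/-- This polynomial vanishes exactly at the degenerate parametrizations. -/
noncomputable def degeneracy (Θ : HMPParam d ℝ) : ℝ :=
  Θ.rowMatrix.det * Θ.colMatrix.det * (Θ.M.det * (vandermonde fun i => Θ.E i 0).det)

theorem degeneracy_ne_zero_iff {Θ : HMPParam d ℝ} : Θ.degeneracy ≠ 0 ↔
    (Θ.rowMatrix.det ≠ 0 ∧ Θ.colMatrix.det ≠ 0) ∧ Θ.M.det ≠ 0 ∧
      Function.Injective fun i => Θ.E i 0 := by
  rw [degeneracy, mul_ne_zero_iff, mul_ne_zero_iff, mul_ne_zero_iff, det_vandermonde_ne_zero_iff]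

theorem row_mul_mul_col (Θ : HMPParam d ℝ) (X : Matrix (Fin d) (Fin d) ℝ) (k l : Fin d) :
    (Θ.rowMatrix * X * Θ.colMatrix) k l =
      Θ.π ⬝ᵥ ((Θ.T 0 ^ (k : ℕ) * X * Θ.T 0 ^ (l : ℕ)) *ᵥ fun _ => 1) := by
  rw [← mulVec_mulVec, ← mulVec_mulVec, dotProduct_mulVec, dotProduct_mulVec]
  rfl

/-- A Hankel-type matrix of word probabilities factors through the hidden states; comparing such
factorizations recovers the parameters up to a change of basis. -/
theorem row_mul_col (Θ : HMPParam d ℝ) (k l : Fin d) :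
    (Θ.rowMatrix * Θ.colMatrix) k l =
      Θ.word (List.replicate k 0 ++ List.replicate l 0) := by
  have := Θ.row_mul_mul_col 1 k l
  rw [mul_one, mul_one] at this
  simp [this, word, ← pow_add]

theorem row_mul_T_mul_col (Θ : HMPParam d ℝ) (a : Fin 2) (k l : Fin d) :
    (Θ.rowMatrix * Θ.T a * Θ.colMatrix) k l =
      Θ.word (List.replicate k 0 ++ a :: List.replicate l 0) := by
  simp [row_mul_mul_col, word, mul_assoc]

/-- A matrix that intertwines two diagonal matrices, the first one with distinct entries, and
preserves `𝟏` permutes the coordinates. -/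
theorem exists_perm_of_intertwine {S : Matrix (Fin d) (Fin d) ℝ} (hS : S.det ≠ 0)
    {e e' : Fin d → ℝ} (he : Function.Injective e) (h : S * diagonal e' = diagonal e * S)
    (h1 : (S *ᵥ fun _ => 1) = fun _ => 1) :
    ∃ σ : Equiv.Perm (Fin d), S = of fun i j => if i = σ j then 1 else 0 := by
  have hij : ∀ i j, S i j ≠ 0 → e i = e' j := by
    intro i j hne
    have := congrFun (congrFun h i) j
    rw [mul_diagonal, diagonal_mul, mul_comm] at this
    exact (mul_right_cancel₀ hne this).symm
  -- Distinctness of the `e i` leaves at most one nonzero entry in each column. Invertibility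
  -- forbids zero columns and rows, and the row sums make the remaining entries equal to one.
  have hcol : ∀ j, ∃ i, S i j ≠ 0 := by
    intro j
    by_contra! hj
    exact hS (det_eq_zero_of_column_eq_zero j hj)
  choose f hf using hcol
  have hsupp : ∀ i j, S i j ≠ 0 → i = f j := fun i j hne =>
    he ((hij i j hne).trans (hij (f j) j (hf j)).symm)
  have hsurj : Function.Surjective f := by
    intro i
    by_contra! hi
    refine hS (det_eq_zero_of_row_eq_zero i fun j => ?_)
    by_contra hne
    exact hi j (hsupp i j hne).symm
  have hbij : Function.Bijective f := ⟨Finite.injective_iff_surjective.2 hsurj, hsurj⟩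
  refine ⟨Equiv.ofBijective f hbij, ?_⟩
  ext i j
  simp only [of_apply, Equiv.ofBijective_apply]
  split_ifs with hi
  · have hrow := congrFun h1 i
    simp only [mulVec, dotProduct, mul_one] at hrow
    rw [Finset.sum_eq_single j] at hrow
    · exact hrow
    · intro k _ hk
      by_contra hne
      exact hk (hbij.1 ((hsupp i k hne).symm.trans hi))
    · simp
  · by_contra hne
    exact hi (hsupp i j hne)

/-- A nondegenerate normalized parametrization is determined by its law on words of length
`n ≥ 2 d - 1`, up to the numbering of the hidden states. -/
theorem eq_permute_of_law_eq (hd : 1 ≤ d) {n : ℕ} (hn : 2 * d ≤ n + 1) {Θ Θ' : HMPParam d ℝ}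
    (h : Θ.Normalized) (h' : Θ'.Normalized) (h0 : Θ.degeneracy ≠ 0) (hlaw : Θ'.law n = Θ.law n) :
    (∃ σ : Equiv.Perm (Fin d), Θ' = Θ.permute σ) ∧ Θ'.degeneracy ≠ 0 := by
  obtain ⟨⟨hA, hB⟩, hM, he⟩ := degeneracy_ne_zero_iff.1 h0
  have hw : ∀ w : List (Fin 2), w.length ≤ n → Θ'.word w = Θ.word w := fun w =>
    word_eq_of_law_eq h h' hlaw
  have hAB : Θ'.rowMatrix * Θ'.colMatrix = Θ.rowMatrix * Θ.colMatrix := by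
    ext k l
    rw [row_mul_col, row_mul_col]
    exact hw _ (by simp; omega)
  -- The longest word here has length (d - 1) + 1 + (d - 1) = 2d - 1, which is where the bound on
  -- `n` is used in full.
  have hATB : ∀ a, Θ'.rowMatrix * Θ'.T a * Θ'.colMatrix = Θ.rowMatrix * Θ.T a * Θ.colMatrix := by
    intro a
    ext k l
    rw [row_mul_T_mul_col, row_mul_T_mul_col]
    exact hw _ (by simp; omega)
  have hdet := congrArg det hAB
  rw [det_mul, det_mul] at hdet
  obtain ⟨hA', hB'⟩ := mul_ne_zero_iff.1 (hdet ▸ mul_ne_zero hA hB)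
  set A := Θ.rowMatrix with hAdef
  set B := Θ.colMatrix with hBdef
  set A' := Θ'.rowMatrix with hAdef'
  set B' := Θ'.colMatrix with hBdef'
  have uA : IsUnit A.det := hA.isUnit
  have uB' : IsUnit B'.det := hB'.isUnit
  obtain ⟨S, hAS⟩ : ∃ S, A * S = A' :=
    ⟨A⁻¹ * A', by rw [← mul_assoc, mul_nonsing_inv _ uA, one_mul]⟩
  have cancelA : ∀ {X Y : Matrix (Fin d) (Fin d) ℝ}, A * X = A * Y → X = Y := fun {X Y} hXY => by
    have := congrArg (A⁻¹ * ·) hXY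
    simpa only [← mul_assoc, nonsing_inv_mul _ uA, one_mul] using this
  have hSB : S * B' = B := cancelA (by rw [← mul_assoc, hAS, hAB])
  have hST : ∀ a, S * Θ'.T a = Θ.T a * S := by
    intro a
    have h1 : S * Θ'.T a * B' = Θ.T a * S * B' := cancelA (by
      rw [mul_assoc _ S B', hSB, ← mul_assoc, ← mul_assoc, ← mul_assoc, hAS, hATB])
    have := congrArg (· * B'⁻¹) h1
    simpa only [mul_assoc, mul_nonsing_inv _ uB', mul_one] using this
  have hS : S.det ≠ 0 := by
    intro hS
    rw [← hAS, det_mul, hS, mul_zero] at hA'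
    exact hA' rfl
  have hSM : S * Θ'.M = Θ.M * S := by
    rw [← h.T_add_T, ← h'.T_add_T, mul_add, add_mul, hST, hST]
  have hM' : Θ'.M.det ≠ 0 := by
    have := congrArg det hSM
    rw [det_mul, det_mul] at this
    intro h0
    rw [h0, mul_zero] at this
    exact mul_ne_zero hM hS this.symm
  -- From S O' M' = O M S = O S M' the invertible factor M' is cancelled.
  have hSO : S * diagonal (fun i => Θ'.E i 0) = diagonal (fun i => Θ.E i 0) * S := by
    have h1 := hST 0
    rw [T, T, ← mul_assoc, mul_assoc _ Θ.M, ← hSM, ← mul_assoc] at h1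
    have := congrArg (· * Θ'.M⁻¹) h1
    simpa only [mul_assoc, mul_nonsing_inv _ hM'.isUnit, mul_one] using this
  have hS1 : (S *ᵥ fun _ => 1) = fun _ => 1 := by
    ext i
    -- Column zero of both column matrices is T_0^0 𝟏 = 𝟏, so S B' = B contains S 𝟏 = 𝟏.
    have hB1 : ∀ i, B i ⟨0, hd⟩ = 1 := by simp [hBdef, colMatrix]
    have hB1' : ∀ i, B' i ⟨0, hd⟩ = 1 := by simp [hBdef', colMatrix]
    have := congrFun (congrFun hSB i) ⟨0, hd⟩
    simp only [mul_apply, hB1, hB1'] at this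
    exact this
  obtain ⟨σ, hσ⟩ := exists_perm_of_intertwine hS he hSO hS1
  have hE : ∀ j, Θ'.E j 0 = Θ.E (σ j) 0 := by
    intro j
    have := congrFun (congrFun hSO (σ j)) j
    simpa [mul_diagonal, diagonal_mul, hσ] using this
  have hperm : Θ' = Θ.permute σ := by
    obtain ⟨M', E', p'⟩ := Θ'
    rw [permute]
    congr 1
    · ext j k
      have := congrFun (congrFun hSM (σ j)) k
      simpa [hσ, mul_apply] using this
    · ext j a
      have h1 := h.2.1 (σ j)
      have h2 := h'.2.1 j
      rw [Fin.sum_univ_two] at h1 h2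
      have h3 := hE j
      fin_cases a
      · exact h3
      · simp only [Fin.mk_one] at *
        linarith
    · ext j
      -- Row zero of A S = A' compares the initial vectors.
      have := congrFun (congrFun hAS ⟨0, hd⟩) j
      simpa [hAdef, hAdef', rowMatrix, mul_apply, hσ] using this.symm
  refine ⟨⟨σ, hperm⟩, degeneracy_ne_zero_iff.2 ⟨⟨hA', hB'⟩, hM', ?_⟩⟩
  intro j k hjk
  simp only [hE] at hjk
  exact σ.injective (he hjk)

/-! ### Renumbering the hidden states -/

theorem T_permute (σ : Equiv.Perm (Fin d)) (Θ : HMPParam d ℝ) (a : Fin 2) :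
    (Θ.permute σ).T a = (Θ.T a).submatrix σ σ := by
  ext i j
  rw [submatrix_apply, T_apply, T_apply]
  rfl

theorem word_permute (σ : Equiv.Perm (Fin d)) (Θ : HMPParam d ℝ) (w : List (Fin 2)) :
    (Θ.permute σ).word w = Θ.word w := by
  have hprod : (w.map (Θ.permute σ).T).prod = ((w.map Θ.T).prod).submatrix σ σ := by
    induction w with
    | nil => simp
    | cons a w ih =>
      rw [List.map_cons, List.prod_cons, ih, T_permute, submatrix_mul_equiv, List.map_cons,
        List.prod_cons]
  rw [word, word, hprod]
  simp only [dotProduct, mulVec, submatrix_apply, permute]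
  refine Eq.trans (Finset.sum_congr rfl fun i _ => ?_)
    (Equiv.sum_comp σ fun i => Θ.π i * ∑ j, (w.map Θ.T).prod i j * 1)
  exact congrArg _ (Equiv.sum_comp σ fun j => (w.map Θ.T).prod (σ i) j * 1)

theorem law_permute (n : ℕ) (σ : Equiv.Perm (Fin d)) (Θ : HMPParam d ℝ) :
    (Θ.permute σ).law n = Θ.law n := by
  ext v
  rw [law_eq_word, law_eq_word, word_permute]

theorem Stochastic.permute {Θ : HMPParam d ℝ} (h : Θ.Stochastic) (σ : Equiv.Perm (Fin d)) :
    (Θ.permute σ).Stochastic := by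
  obtain ⟨⟨h1, h2, h3⟩, h4, h5, h6⟩ := h
  refine ⟨⟨fun i => ?_, fun i => h2 (σ i), ?_⟩, fun i j => h4 _ _, fun i a => h5 _ _, fun i => h6 _⟩
  · rw [← h1 (σ i)]
    exact Equiv.sum_comp σ fun j => Θ.M (σ i) j
  · rw [← h3]
    exact Equiv.sum_comp σ Θ.π

/-- If the first letter has distinct emission probabilities, then the hidden states can be sorted
by these in a unique way. -/
theorem exists_permute_strictMono {Θ : HMPParam d ℝ} (he : Function.Injective fun i => Θ.E i 0) :
    ∃ σ : Equiv.Perm (Fin d), StrictMono fun i => (Θ.permute σ).E i 0 :=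
  ⟨Tuple.sort fun i => Θ.E i 0, (Tuple.monotone_sort _).strictMono_of_injective
    (he.comp (Equiv.injective _))⟩

/-- Two sorted numberings differ by an order automorphism of a finite chain, and the identity is the
only one. -/
theorem permute_eq_self {Θ : HMPParam d ℝ} {σ : Equiv.Perm (Fin d)}
    (h : StrictMono fun i => Θ.E i 0) (h' : StrictMono fun i => (Θ.permute σ).E i 0) :
    Θ.permute σ = Θ := by
  have hσ : StrictMono σ := fun i j hij => h.lt_iff_lt.1 (h' hij)
  have : (σ : Fin d → Fin d) = id := by
    have e : (hσ.orderIsoOfSurjective σ σ.surjective) = OrderIso.refl _ := Subsingleton.elim _ _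
    funext i
    exact congrArg (fun f : Fin d ≃o Fin d => f i) e
  have hi : ∀ i, σ i = i := congrFun this
  obtain ⟨M, E, p⟩ := Θ
  simp [permute, hi]

/-! ### Polynomial dependence on the parameters -/

theorem isRatPoly_word {σ : Type} {Θ : (σ → ℝ) → HMPParam d ℝ}
    (hM : ∀ i j, IsRatPoly fun y => (Θ y).M i j) (hE : ∀ i a, IsRatPoly fun y => (Θ y).E i a)
    (hπ : ∀ i, IsRatPoly fun y => (Θ y).π i) (w : List (Fin 2)) :
    IsRatPoly fun y => (Θ y).word w := by
  have hT : ∀ a i j, IsRatPoly fun y => (Θ y).T a i j := fun a i j => by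
    simpa only [T_apply] using (hE i a).mul (hM i j)
  simp only [word, dotProduct, mulVec]
  exact .sum _ fun i => (hπ i).mul (.sum _ fun j => (IsRatPoly.list_prod hT w i j).mul .one)

theorem isRatPoly_degeneracy {σ : Type} {Θ : (σ → ℝ) → HMPParam d ℝ}
    (hM : ∀ i j, IsRatPoly fun y => (Θ y).M i j) (hE : ∀ i a, IsRatPoly fun y => (Θ y).E i a)
    (hπ : ∀ i, IsRatPoly fun y => (Θ y).π i) : IsRatPoly fun y => (Θ y).degeneracy := by
  have hT : ∀ a i j, IsRatPoly fun y => (Θ y).T a i j := fun a i j => by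
    simpa only [T_apply] using (hE i a).mul (hM i j)
  have hpow : ∀ (k : ℕ) i j, IsRatPoly fun y => ((Θ y).T 0 ^ k) i j := fun k i j => by
    simpa using IsRatPoly.list_prod hT (List.replicate k 0) i j
  have hrow : IsRatPoly fun y => (Θ y).rowMatrix.det := .det fun k i => by
    simp only [rowMatrix, of_apply, vecMul, dotProduct]
    exact .sum _ fun j => (hπ j).mul (hpow _ _ _)
  have hcol : IsRatPoly fun y => (Θ y).colMatrix.det := .det fun i k => by
    simp only [colMatrix, of_apply, mulVec, dotProduct]
    exact .sum _ fun j => (hpow _ _ _).mul .one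
  have hvan : IsRatPoly fun y => (vandermonde fun i => (Θ y).E i 0).det := .det fun i k => by
    simp only [vandermonde_apply]
    simpa using IsRatPoly.prod (Finset.range k) fun _ => hE i 0
  exact (hrow.mul hcol).mul ((IsRatPoly.det hM).mul hvan)

/-- The normalized parametrization with given coordinates. -/
def ofCoords (z : ParamIdx d → ℝ) : HMPParam d ℝ where
  M i j := if h : (j : ℕ) < d - 1 then z (.inl (i, ⟨j, h⟩)) else 1 - ∑ k, z (.inl (i, k))
  E i := ![z (.inr (.inl i)), 1 - z (.inr (.inl i))]
  π i := if h : (i : ℕ) < d - 1 then z (.inr (.inr ⟨i, h⟩)) else 1 - ∑ k, z (.inr (.inr k))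

theorem coords_ofCoords (z : ParamIdx d → ℝ) : (ofCoords z).coords = z := by
  ext (⟨i, j⟩ | i | i) <;> simp [coords, ofCoords]

theorem ofCoords_normalized (hd : 1 ≤ d) (z : ParamIdx d → ℝ) : (ofCoords z).Normalized := by
  obtain ⟨k, rfl⟩ : ∃ k, d = k + 1 := ⟨d - 1, by omega⟩
  refine ⟨fun i => ?_, fun i => ?_, ?_⟩
  · simp [ofCoords, Fin.sum_univ_castSucc]
  · simp [ofCoords]
  · simp [ofCoords, Fin.sum_univ_castSucc]

theorem ofCoords_coords (hd : 1 ≤ d) {Θ : HMPParam d ℝ} (h : Θ.Normalized) :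
    ofCoords Θ.coords = Θ :=
  (coords_bijOn hd).injOn (ofCoords_normalized hd _) h (coords_ofCoords _)

/-- With M the identity, e_{i0} = i and π uniform, both matrices reduce to Vandermonde matrices up
to transposition and scaling. The emissions need not lie in [0, 1], since only the normalization
matters. -/
theorem exists_degeneracy_ne_zero (hd : 1 ≤ d) :
    ∃ Θ : HMPParam d ℝ, Θ.Normalized ∧ Θ.degeneracy ≠ 0 := by
  have hd0 : (d : ℝ) ≠ 0 := by positivity
  let e : Fin d → ℝ := fun i => (i : ℕ)
  have he : Function.Injective e := fun i j hij => Fin.ext (Nat.cast_injective hij)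
  have hvan := det_vandermonde_ne_zero_iff.2 he
  let Θ : HMPParam d ℝ := ⟨1, fun i => ![e i, 1 - e i], fun _ => (d : ℝ)⁻¹⟩
  have hpow : ∀ k : ℕ, Θ.T 0 ^ k = diagonal fun i => e i ^ k := fun k => by
    simp only [Θ, T, mul_one, cons_val_zero, diagonal_pow]
    rfl
  have hrow : Θ.rowMatrix = (d : ℝ)⁻¹ • (vandermonde e)ᵀ := by
    ext k i
    simp [rowMatrix, hpow, vecMul_diagonal, Θ, vandermonde_apply]
  have hcol : Θ.colMatrix = vandermonde e := by
    ext k i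
    simp [colMatrix, hpow, mulVec_diagonal, vandermonde_apply]
  refine ⟨Θ, ⟨fun i => ?_, fun i => ?_, ?_⟩, degeneracy_ne_zero_iff.2 ⟨⟨?_, ?_⟩, ?_, he⟩⟩
  · simp [Θ, one_apply]
  · simp [Θ]
  · simp [Θ, hd0]
  · rw [hrow, det_smul, det_transpose]
    exact mul_ne_zero (pow_ne_zero _ (inv_ne_zero hd0)) hvan
  · rwa [hcol]
  · simp [Θ]

/-- The degenerate parametrizations, in coordinates. -/
def degenerateSet (d : ℕ) : Set (ParamIdx d → ℝ) :=
  {z | (ofCoords z).degeneracy = 0}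

theorem coords_mem_degenerateSet (hd : 1 ≤ d) {Θ : HMPParam d ℝ} (h : Θ.Normalized) :
    Θ.coords ∈ degenerateSet d ↔ Θ.degeneracy = 0 := by
  rw [degenerateSet, Set.mem_ofPred_eq, ofCoords_coords hd h]

theorem exists_polynomial_degenerateSet (hd : 1 ≤ d) : ∃ p : MvPolynomial (ParamIdx d) ℝ,
    p ≠ 0 ∧ ∀ z, z ∈ degenerateSet d ↔ MvPolynomial.aeval z p = 0 := by
  have hM : ∀ i j, IsRatPoly fun z => (ofCoords (d := d) z).M i j := fun i j => by
    simp only [ofCoords]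
    split_ifs
    exacts [.coord _, IsRatPoly.one.sub (.sum _ fun k => .coord _)]
  have hE : ∀ i a, IsRatPoly fun z => (ofCoords (d := d) z).E i a := fun i a => by
    fin_cases a
    exacts [.coord _, IsRatPoly.one.sub (.coord _)]
  have hπ : ∀ i, IsRatPoly fun z => (ofCoords (d := d) z).π i := fun i => by
    simp only [ofCoords]
    split_ifs
    exacts [.coord _, IsRatPoly.one.sub (.sum _ fun k => .coord _)]
  obtain ⟨p, hp⟩ := isRatPoly_degeneracy hM hE hπ
  have hz : ∀ z, z ∈ degenerateSet d ↔
      MvPolynomial.aeval z (MvPolynomial.map (algebraMap ℚ ℝ) p) = 0 := fun z => by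
    rw [MvPolynomial.aeval_map_algebraMap, hp]
    rfl
  refine ⟨_, fun h0 => ?_, hz⟩
  obtain ⟨Θ, hΘ, hne⟩ := exists_degeneracy_ne_zero hd
  exact hne ((coords_mem_degenerateSet hd hΘ).1 ((hz _).2 (by rw [h0, map_zero])))

theorem isRealVariety_degenerateSet (hd : 1 ≤ d) : IsRealVariety (degenerateSet d) := by
  obtain ⟨p, -, hp⟩ := exists_polynomial_degenerateSet hd
  refine ⟨Ideal.span {p}, ?_⟩
  ext z
  rw [MvPolynomial.zeroLocus_span, hp]
  simp

theorem realVarietyDim_degenerateSet_lt (hd : 1 ≤ d) :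
    realVarietyDim (degenerateSet d) < ((d ^ 2 + d - 1 : ℕ) : WithBot ℕ∞) := by
  obtain ⟨p, hp0, hp⟩ := exists_polynomial_degenerateSet hd
  rw [← card_paramIdx hd, ← Nat.card_eq_fintype_card]
  exact realVarietyDim_lt hp0 fun z hz => (hp z).1 hz

end HMPParam

end

/-! ### Computation trees -/

section Computation

variable {ι κ : Type} {d : ℕ}

/-- Polynomials with rational coefficients can be evaluated. -/
theorem RealExpr.exists_eval_eq_aeval (u : κ → RealExpr ι) (p : MvPolynomial κ ℚ) :
    ∃ e : RealExpr ι, ∀ x, e.eval x = MvPolynomial.aeval (fun k => (u k).eval x) p := by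
  induction p using MvPolynomial.induction_on with
  | C q => exact ⟨.const q, fun x => by simp [RealExpr.eval]⟩
  | add p q hp hq =>
    obtain ⟨e, he⟩ := hp
    obtain ⟨f, hf⟩ := hq
    exact ⟨.add e f, fun x => by simp [RealExpr.eval, he, hf]⟩
  | mul_X p i hp =>
    obtain ⟨e, he⟩ := hp
    exact ⟨.mul e (u i), fun x => by simp [RealExpr.eval, he]⟩

/-- The roots of a polynomial whose coefficients are polynomials in the input can be computed. -/
theorem RealExpr.exists_eval_eq_root (c : MvPolynomial (Option ι) ℚ) :
    ∃ L : List (RealExpr ι), ∀ (x : ι → ℝ) (t : ℝ),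
      t ∈ ((MvPolynomial.optionEquivLeft ℚ ι c).map
        (MvPolynomial.aeval x : MvPolynomial ι ℚ →ₐ[ℚ] ℝ).toRingHom).roots →
      ∃ e ∈ L, e.eval x = t := by
  set q := MvPolynomial.optionEquivLeft ℚ ι c
  choose f hf using fun i : ℕ => RealExpr.exists_eval_eq_aeval RealExpr.input (q.coeff i)
  -- The degree of `q` bounds the number of roots of every specialization, so finitely many root
  -- indices suffice for all inputs.
  refine ⟨(List.range (q.natDegree + 1)).map fun m => .root q.natDegree m fun i => f i,
    fun x t ht => ?_⟩
  set p := q.map (MvPolynomial.aeval x : MvPolynomial ι ℚ →ₐ[ℚ] ℝ).toRingHom with hp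
  have hsum : ∑ i : Fin (q.natDegree + 1),
      Polynomial.C ((f i).eval x) * Polynomial.X ^ (i : ℕ) = p := by
    rw [p.as_sum_range_C_mul_X_pow' (n := q.natDegree + 1)
      (Nat.lt_succ_of_le Polynomial.natDegree_map_le), Finset.sum_range]
    refine Finset.sum_congr rfl fun i _ => ?_
    rw [hf, hp, Polynomial.coeff_map]
    rfl
  have hmem : t ∈ p.roots.toFinset.sort (· ≤ ·) := by simpa using ht
  obtain ⟨m, hm, hmt⟩ := List.getElem_of_mem hmem
  have hlen : m < q.natDegree + 1 := by
    rw [Finset.length_sort] at hm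
    have h1 := Multiset.toFinset_card_le p.roots
    have h2 := p.card_roots'
    have h3 : p.natDegree ≤ q.natDegree := Polynomial.natDegree_map_le
    omega
  refine ⟨_, List.mem_map.2 ⟨m, List.mem_range.2 hlen, rfl⟩, ?_⟩
  rw [RealExpr.eval, nthRealRoot, hsum, List.getD_eq_getElem _ _ hm, hmt]

/-- The expressions in `L` have the same signs at `x` and at `x'`. -/
def ExprSignEq (L : List (RealExpr ι)) (x x' : ι → ℝ) : Prop :=
  ∀ e ∈ L, SignType.sign (e.eval x) = SignType.sign (e.eval x')

theorem ExprSignEq.symm {L : List (RealExpr ι)} {x x' : ι → ℝ} (h : ExprSignEq L x x') :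
    ExprSignEq L x' x :=
  fun e he => (h e he).symm

/-- Membership of a computed point in a semialgebraic set can be decided. -/
theorem Semialgebraic.exists_test {s : Set (κ → ℝ)} (hs : Semialgebraic s) (u : κ → RealExpr ι) :
    ∃ L : List (RealExpr ι), ∀ x x', ExprSignEq L x x' →
      (fun k => (u k).eval x) ∈ s → (fun k => (u k).eval x') ∈ s := by
  obtain ⟨C, hC⟩ := hs
  choose f hf using RealExpr.exists_eval_eq_aeval u
  refine ⟨C.toList.map f, fun x x' h => hC _ _ fun c hc => ?_⟩
  simpa only [hf] using h (f c) (List.mem_map_of_mem (Finset.mem_toList.2 hc))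

theorem Semialgebraic.exists_test_input {s : Set (ι → ℝ)} (hs : Semialgebraic s) :
    ∃ L : List (RealExpr ι), ∀ x x', ExprSignEq L x x' → x ∈ s → x' ∈ s :=
  hs.exists_test RealExpr.input

/-- Points that are unique in their fibre of a semialgebraic set can be computed. -/
theorem Semialgebraic.exists_candidates {s : Set (Option ι → ℝ)} (hs : Semialgebraic s) :
    ∃ L : List (RealExpr ι), ∀ (x : ι → ℝ) (t : ℝ),
      (∀ t', (fun o : Option ι => o.elim t' x) ∈ s ↔ t' = t) → ∃ e ∈ L, e.eval x = t := by
  obtain ⟨C, hC⟩ := hs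
  choose f hf using RealExpr.exists_eval_eq_root (ι := ι)
  refine ⟨C.toList.flatMap f, fun x t ht => ?_⟩
  obtain ⟨c, hc, hroot⟩ := exists_root_of_unique hC ((ht t).2 rfl) fun t' => (ht t').1
  obtain ⟨e, he, hx⟩ := hf c x t hroot
  exact ⟨e, List.mem_flatMap.2 ⟨c, Finset.mem_toList.2 hc, he⟩, hx⟩

/-- Every answer that depends only on the signs of finitely many expressions is given by a
computation tree. -/
theorem exists_routine_of_signs (L : List (RealExpr ι))
    (ans : List SignType → Answer (HMPParam d (RealExpr ι))) :
    ∃ A : Routine ι d, ∀ x, A.run x =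
      (Routine.print (ans (L.map fun e => SignType.sign (e.eval x)))).run x := by
  induction L generalizing ans with
  | nil => exact ⟨.print (ans []), fun x => rfl⟩
  | cons e L ih =>
    choose A hA using fun s : SignType => ih fun l => ans (s :: l)
    refine ⟨.branch e (A (-1)) (A 0) (A 1), fun x => ?_⟩
    rw [List.map_cons, Routine.run]
    rcases lt_trichotomy (e.eval x) 0 with h | h | h
    · rw [if_pos h, hA, sign_neg h]
    · rw [if_neg h.not_lt, if_pos h, hA, h, sign_zero]
    · rw [if_neg h.not_gt, if_neg h.ne', hA, sign_pos h]

/-- Each sign vector that occurs is given the answer of one chosen input realizing it, which is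
correct for every input with the same signs. Sign vectors that never occur get an arbitrary answer.
-/
theorem exists_routine_of_local (L : List (RealExpr ι))
    {correct : (ι → ℝ) → Answer (HMPParam d ℝ) → Prop}
    (h : ∀ x, ∃ a : Answer (HMPParam d (RealExpr ι)), ∀ x', ExprSignEq L x x' →
      correct x' ((Routine.print a).run x')) :
    ∃ A : Routine ι d, ∀ x, correct x (A.run x) := by
  classical
  choose a ha using h
  obtain ⟨A, hA⟩ := exists_routine_of_signs L fun w =>
    if hw : ∃ x, (L.map fun e => SignType.sign (e.eval x)) = w then a hw.choose else .noHMP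
  refine ⟨A, fun x => ?_⟩
  have hw : ∃ x', (L.map fun e => SignType.sign (e.eval x')) =
      L.map fun e => SignType.sign (e.eval x) := ⟨x, rfl⟩
  rw [hA, dif_pos hw]
  exact ha _ _ fun e he => List.map_inj_left.1 hw.choose_spec e he

end Computation

/-! ### Sorted models and their semialgebraic description -/

namespace HMPParam

variable {d n : ℕ} {κ : Type}

/-- Indices for all entries of a triple `(M, E, π)`. -/
abbrev EntryIdx (d : ℕ) : Type := (Fin d × Fin d) ⊕ (Fin d × Fin 2) ⊕ Fin d

/-- The triple with given entries. -/
def ofEntries {R : Type} (t : EntryIdx d → R) : HMPParam d R where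
  M i j := t (.inl (i, j))
  E i a := t (.inr (.inl (i, a)))
  π i := t (.inr (.inr i))

theorem exists_ofEntries {R : Type} (Θ : HMPParam d R) : ∃ t, ofEntries t = Θ :=
  ⟨Sum.elim (fun p => Θ.M p.1 p.2) (Sum.elim (fun p => Θ.E p.1 p.2) Θ.π), rfl⟩

theorem ofEntries_injective {R : Type} :
    Function.Injective (ofEntries : (EntryIdx d → R) → HMPParam d R) := by
  intro t t' h
  ext (⟨i, j⟩ | ⟨i, a⟩ | i)
  · exact congrFun (congrFun (congrArg HMPParam.M h) i) j
  · exact congrFun (congrFun (congrArg HMPParam.E h) i) a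
  · exact congrFun (congrArg HMPParam.π h) i

/-- The nondegenerate stochastic triples with law `P` and sorted hidden states. -/
def SortedModel (n : ℕ) (P : (Fin n → Fin 2) → ℝ) (Θ : HMPParam d ℝ) : Prop :=
  Θ.Stochastic ∧ Θ.degeneracy ≠ 0 ∧ (StrictMono fun i => Θ.E i 0) ∧ Θ.law n = P

theorem SortedModel.unique (hd : 1 ≤ d) (hn : 2 * d ≤ n + 1) {P : (Fin n → Fin 2) → ℝ}
    {Θ Θ' : HMPParam d ℝ} (h : SortedModel n P Θ) (h' : SortedModel n P Θ') : Θ' = Θ := by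
  obtain ⟨⟨σ, rfl⟩, -⟩ := eq_permute_of_law_eq hd hn h.1.1 h'.1.1 h.2.1 (h'.2.2.2.trans h.2.2.2.symm)
  exact permute_eq_self h.2.2.1 h'.2.2.1

/-- Renumbering changes neither the law nor nondegeneracy, so asking for sorted states loses no law.
-/
theorem exists_sortedModel_iff (hd : 1 ≤ d) (hn : 2 * d ≤ n + 1) {P : (Fin n → Fin 2) → ℝ} :
    (∃ t : EntryIdx d → ℝ, SortedModel n P (ofEntries t)) ↔
      P ∈ HMPParam.law n '' {Θ : HMPParam d ℝ | Θ.Stochastic ∧ Θ.coords ∉ degenerateSet d} := by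
  constructor
  · rintro ⟨t, h1, h2, -, h3⟩
    exact ⟨_, ⟨h1, by rwa [coords_mem_degenerateSet hd h1.1]⟩, h3⟩
  · rintro ⟨Θ, ⟨h1, h2⟩, rfl⟩
    rw [coords_mem_degenerateSet hd h1.1] at h2
    obtain ⟨σ, hσ⟩ := exists_permute_strictMono (degeneracy_ne_zero_iff.1 h2).2.2
    obtain ⟨t, ht⟩ := exists_ofEntries (Θ.permute σ)
    refine ⟨t, ?_⟩
    rw [ht]
    exact ⟨h1.permute σ, (eq_permute_of_law_eq hd hn h1.1 (h1.permute σ).1 h2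
      (law_permute n σ Θ)).2, hσ, law_permute n σ Θ⟩

/-! ### The relevant sets are semialgebraic -/

theorem isRatPoly_word_ofEntries (w : List (Fin 2)) :
    IsRatPoly fun y : κ ⊕ EntryIdx d → ℝ => (ofEntries (y ∘ .inr)).word w :=
  isRatPoly_word (Θ := fun y : κ ⊕ EntryIdx d → ℝ => ofEntries (y ∘ .inr))
    (fun _ _ => .coord _) (fun _ _ => .coord _) (fun _ => .coord _) w

theorem isRatPoly_degeneracy_ofEntries :
    IsRatPoly fun y : κ ⊕ EntryIdx d → ℝ => (ofEntries (y ∘ .inr)).degeneracy :=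
  isRatPoly_degeneracy (Θ := fun y : κ ⊕ EntryIdx d → ℝ => ofEntries (y ∘ .inr))
    (fun _ _ => .coord _) (fun _ _ => .coord _) (fun _ => .coord _)

theorem semialgebraic_normalized :
    Semialgebraic {y : κ ⊕ EntryIdx d → ℝ | (ofEntries (y ∘ .inr)).Normalized} := by
  have h1 : Semialgebraic {y : κ ⊕ EntryIdx d → ℝ | ∀ i, ∑ j, y (.inr (.inl (i, j))) = 1} := by
    rw [Set.ofPred_forall]
    exact .iInter fun i => (IsRatPoly.sum _ fun j => .coord _).semialgebraic_eq .one
  have h2 : Semialgebraic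
      {y : κ ⊕ EntryIdx d → ℝ | ∀ i, ∑ a, y (.inr (.inr (.inl (i, a)))) = 1} := by
    rw [Set.ofPred_forall]
    exact .iInter fun i => (IsRatPoly.sum _ fun j => .coord _).semialgebraic_eq .one
  have h3 : Semialgebraic {y : κ ⊕ EntryIdx d → ℝ | ∑ i, y (.inr (.inr (.inr i))) = 1} :=
    (IsRatPoly.sum _ fun j => .coord _).semialgebraic_eq .one
  exact h1.inter (h2.inter h3)

theorem semialgebraic_nonneg :
    Semialgebraic {y : κ ⊕ EntryIdx d → ℝ | ∀ i, 0 ≤ y (.inr i)} := by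
  rw [Set.ofPred_forall]
  exact .iInter fun i => IsRatPoly.zero.semialgebraic_le (.coord _)

theorem semialgebraic_law :
    Semialgebraic {y : (Fin n → Fin 2) ⊕ EntryIdx d → ℝ |
      (ofEntries (y ∘ .inr)).law n = y ∘ .inl} := by
  simp only [funext_iff, law_eq_word]
  rw [Set.ofPred_forall]
  exact .iInter fun v => (isRatPoly_word_ofEntries _).semialgebraic_eq (.coord _)

theorem semialgebraic_sorted :
    Semialgebraic {y : κ ⊕ EntryIdx d → ℝ | StrictMono fun i => (ofEntries (y ∘ .inr)).E i 0} := by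
  have h : Semialgebraic {y : κ ⊕ EntryIdx d → ℝ | ∀ p : {p : Fin d × Fin d // p.1 < p.2},
      y (.inr (.inr (.inl (p.1.1, 0)))) < y (.inr (.inr (.inl (p.1.2, 0))))} := by
    rw [Set.ofPred_forall]
    exact .iInter fun p => (IsRatPoly.coord _).semialgebraic_lt (.coord _)
  convert h using 1
  ext y
  exact ⟨fun hy p => hy p.2, fun hy i j hij => hy ⟨(i, j), hij⟩⟩

theorem semialgebraic_sortedModel :
    Semialgebraic {y : (Fin n → Fin 2) ⊕ EntryIdx d → ℝ |
      SortedModel n (y ∘ .inl) (ofEntries (y ∘ .inr))} := by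
  convert (semialgebraic_normalized.inter semialgebraic_nonneg).inter
    ((isRatPoly_degeneracy_ofEntries.semialgebraic_ne .zero).inter
      (semialgebraic_sorted.inter (semialgebraic_law (n := n) (d := d)))) using 1
  ext y
  have : (∀ i, 0 ≤ y (.inr i)) ↔ (∀ i j, 0 ≤ (ofEntries (y ∘ .inr)).M i j) ∧
      (∀ i a, 0 ≤ (ofEntries (y ∘ .inr)).E i a) ∧ ∀ i, 0 ≤ (ofEntries (y ∘ .inr)).π i := by
    simp only [Sum.forall, Prod.forall]
    rfl
  simp only [SortedModel, Stochastic, Set.mem_ofPred_eq, Set.mem_inter_iff, this]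

theorem semialgebraic_exists_sortedModel :
    Semialgebraic {P : (Fin n → Fin 2) → ℝ |
      ∃ t : EntryIdx d → ℝ, SortedModel n P (ofEntries t)} :=
  semialgebraic_sortedModel.exists_sum

/-- The entries of the sorted models depend semialgebraically on the law. -/
theorem semialgebraic_entry (j : EntryIdx d) :
    Semialgebraic {q : Option (Fin n → Fin 2) → ℝ |
      ∃ t : EntryIdx d → ℝ, SortedModel n (q ∘ some) (ofEntries t) ∧ t j = q none} :=
  Semialgebraic.exists_sum (s := {y : Option (Fin n → Fin 2) ⊕ EntryIdx d → ℝ |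
    SortedModel n ((y ∘ .inl) ∘ some) (ofEntries (y ∘ .inr)) ∧ y (.inr j) = y (.inl none)})
    ((semialgebraic_sortedModel.preimage_comp (Sum.map some id)).inter
      ((IsRatPoly.coord _).semialgebraic_eq (.coord _)))

/-- This image is a projection of a set cut out by polynomial equations in the law and the entries.
-/
theorem semialgebraic_law_image_degenerate (hd : 1 ≤ d) :
    Semialgebraic (HMPParam.law n ''
      {Θ : HMPParam d ℝ | Θ.Normalized ∧ Θ.coords ∈ degenerateSet d}) := by
  convert (semialgebraic_normalized.inter
    ((isRatPoly_degeneracy_ofEntries.semialgebraic_eq .zero).inter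
      (semialgebraic_law (n := n) (d := d)))).exists_sum using 1
  ext P
  constructor
  · rintro ⟨Θ, ⟨h1, h2⟩, rfl⟩
    obtain ⟨t, rfl⟩ := exists_ofEntries Θ
    exact ⟨t, h1, (coords_mem_degenerateSet hd h1).1 h2, rfl⟩
  · rintro ⟨t, h1, h2, h3⟩
    exact ⟨ofEntries t, ⟨h1, (coords_mem_degenerateSet hd h1).2 h2⟩, h3⟩

end HMPParam

/-! ### Construction of the algorithm -/

open HMPParam in
theorem theoremt (d : ℕ) (hd : 1 ≤ d) :
    ∃ N : Set (ParamIdx d → ℝ),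
      IsRealVariety N ∧ realVarietyDim N < ((d ^ 2 + d - 1 : ℕ) : WithBot ℕ∞) ∧
      ∀ n : ℕ, 2 * d ≤ n + 1 →
        ∃ A : Routine (Fin n → Fin 2) d, ∀ P ∈ stdSimplex ℝ (Fin n → Fin 2),
          (P ∈ HMPParam.law n '' {Θ | Θ.Stochastic ∧ Θ.coords ∉ N} →
            ∃ Θ : HMPParam d ℝ, A.run P = Answer.hmp Θ ∧
              Θ.Stochastic ∧ Θ.coords ∉ N ∧ Θ.law n = P ∧
              ∀ Θ' : HMPParam d ℝ, Θ'.Normalized → Θ'.law n = P →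
                ∃ σ : Equiv.Perm (Fin d), Θ' = Θ.permute σ) ∧
          (P ∈ HMPParam.law n '' {Θ : HMPParam d ℝ | Θ.Normalized ∧ Θ.coords ∈ N} →
            A.run P = Answer.cannotDecide) ∧
          (P ∉ HMPParam.law n '' {Θ : HMPParam d ℝ | Θ.Stochastic ∧ Θ.coords ∉ N} →
            P ∉ HMPParam.law n '' {Θ : HMPParam d ℝ | Θ.Normalized ∧ Θ.coords ∈ N} →
            A.run P = Answer.noHMP) := by
  refine ⟨degenerateSet d, isRealVariety_degenerateSet hd, realVarietyDim_degenerateSet_lt hd,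
    fun n hn => ?_⟩
  obtain ⟨L₁, hL₁⟩ := (semialgebraic_exists_sortedModel (d := d) (n := n)).exists_test_input
  obtain ⟨L₂, hL₂⟩ := (semialgebraic_law_image_degenerate (n := n) hd).exists_test_input
  -- `K j` lists candidates for entry `j`, independently of the law; `T j e` collects the
  -- expressions whose signs decide whether `e` computes that entry.
  choose K hK using fun j : EntryIdx d => (semialgebraic_entry (n := n) j).exists_candidates
  choose T hT using fun (j : EntryIdx d) (e : RealExpr (Fin n → Fin 2)) =>
    (semialgebraic_entry (n := n) j).exists_test fun o => o.elim e RealExpr.input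
  -- Uniqueness of the sorted model makes the fibre of the entry graph a single point.
  have hfibre : ∀ {P : (Fin n → Fin 2) → ℝ} {t : EntryIdx d → ℝ},
      SortedModel n P (ofEntries t) → ∀ j r, (fun o : Option (Fin n → Fin 2) => o.elim r P) ∈
        {q : Option (Fin n → Fin 2) → ℝ |
          ∃ t : EntryIdx d → ℝ, SortedModel n (q ∘ some) (ofEntries t) ∧ t j = q none} ↔
        r = t j := by
    intro P t ht j r
    constructor
    · rintro ⟨t', ht', hr⟩
      rw [← ofEntries_injective (ht.unique hd hn ht')]
      exact hr.symm
    · rintro rfl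
      exact ⟨t, ht, rfl⟩
  let L := L₁ ++ (L₂ ++ (Finset.univ : Finset (EntryIdx d)).toList.flatMap fun j =>
    (K j).flatMap (T j))
  have e₁ : ∀ {x x'}, ExprSignEq L x x' → ExprSignEq L₁ x x' := fun h e he =>
    h e (by simp [L, he])
  have e₂ : ∀ {x x'}, ExprSignEq L x x' → ExprSignEq L₂ x x' := fun h e he =>
    h e (by simp [L, he])
  have e₃ : ∀ {x x'}, ExprSignEq L x x' → ∀ j, ∀ c ∈ K j, ExprSignEq (T j c) x x' :=
    fun h j c hc e he => h e (List.mem_append_right _ (List.mem_append_right _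
      (List.mem_flatMap.2 ⟨j, by simp, List.mem_flatMap.2 ⟨c, hc, he⟩⟩)))
  suffices H : ∃ A : Routine (Fin n → Fin 2) d, ∀ P : (Fin n → Fin 2) → ℝ,
      ((∃ t : EntryIdx d → ℝ, SortedModel n P (ofEntries t)) →
        ∃ Θ : HMPParam d ℝ, A.run P = Answer.hmp Θ ∧ SortedModel n P Θ) ∧
      ((¬ ∃ t : EntryIdx d → ℝ, SortedModel n P (ofEntries t)) →
        (P ∈ HMPParam.law n '' {Θ : HMPParam d ℝ | Θ.Normalized ∧ Θ.coords ∈ degenerateSet d} →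
          A.run P = Answer.cannotDecide) ∧
        (P ∉ HMPParam.law n '' {Θ : HMPParam d ℝ | Θ.Normalized ∧ Θ.coords ∈ degenerateSet d} →
          A.run P = Answer.noHMP)) by
    obtain ⟨A, hA⟩ := H
    refine ⟨A, fun P _ => ⟨fun hP => ?_, fun hP => ?_, fun hP hP' => ?_⟩⟩
    · obtain ⟨Θ, hrun, h1, h2, h3, h4⟩ := (hA P).1 ((exists_sortedModel_iff hd hn).2 hP)
      refine ⟨Θ, hrun, h1, by rwa [coords_mem_degenerateSet hd h1.1], h4, fun Θ' hΘ' hlaw => ?_⟩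
      exact (eq_permute_of_law_eq hd hn h1.1 hΘ' h2 (hlaw.trans h4.symm)).1
    · refine ((hA P).2 ?_).1 hP
      -- A law with a nondegenerate stochastic model has no degenerate normalized one, so the first
      -- two cases cannot overlap.
      rintro ⟨t, h1, h2, -, h4⟩
      obtain ⟨Θ, ⟨hΘ, hN⟩, rfl⟩ := hP
      exact (eq_permute_of_law_eq hd hn h1.1 hΘ h2 h4.symm).2
        ((coords_mem_degenerateSet hd hΘ).1 hN)
    · exact ((hA P).2 fun h => hP ((exists_sortedModel_iff hd hn).1 h)).2 hP'
  refine exists_routine_of_local L (correct := fun P ans =>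
      ((∃ t : EntryIdx d → ℝ, SortedModel n P (ofEntries t)) →
        ∃ Θ : HMPParam d ℝ, ans = Answer.hmp Θ ∧ SortedModel n P Θ) ∧
      ((¬ ∃ t : EntryIdx d → ℝ, SortedModel n P (ofEntries t)) →
        (P ∈ HMPParam.law n '' {Θ : HMPParam d ℝ | Θ.Normalized ∧ Θ.coords ∈ degenerateSet d} →
          ans = Answer.cannotDecide) ∧
        (P ∉ HMPParam.law n '' {Θ : HMPParam d ℝ | Θ.Normalized ∧ Θ.coords ∈ degenerateSet d} →
          ans = Answer.noHMP))) fun P => ?_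
  by_cases hP : ∃ t : EntryIdx d → ℝ, SortedModel n P (ofEntries t)
  · obtain ⟨t, ht⟩ := hP
    -- The candidates correct at `P` are printed symbolically. They remain correct at every `P'`
    -- with the same signs, because membership in the entry graph is among the tested conditions.
    choose c hcK hc using fun j => hK j P (t j) (hfibre ht j)
    refine ⟨.hmp (ofEntries c), fun P' hPP' => ?_⟩
    have hP' : ∃ t : EntryIdx d → ℝ, SortedModel n P' (ofEntries t) := hL₁ P P' (e₁ hPP') ⟨t, ht⟩
    refine ⟨fun _ => ?_, fun h => absurd hP' h⟩
    obtain ⟨t', ht'⟩ := hP'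
    refine ⟨_, rfl, ?_⟩
    have hval : ∀ j, (c j).eval P' = t' j := by
      intro j
      refine (hfibre ht' j _).1 ?_
      have helim : ∀ Q : (Fin n → Fin 2) → ℝ,
          (fun o : Option (Fin n → Fin 2) => (o.elim (c j) RealExpr.input).eval Q) =
            fun o : Option (Fin n → Fin 2) => o.elim ((c j).eval Q) Q := fun Q => by
        ext (_ | v) <;> rfl
      have := hT j (c j) P P' (e₃ hPP' j (c j) (hcK j))
      rw [helim, helim] at this
      exact this ((hfibre ht j _).2 (hc j))
    have : (ofEntries c).map (RealExpr.eval P') = ofEntries t' := by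
      rw [← funext hval]
      rfl
    rwa [this]
  · have hout : ∀ {P'}, ExprSignEq L P P' →
        ¬ ∃ t : EntryIdx d → ℝ, SortedModel n P' (ofEntries t) := fun h h' =>
      hP (hL₁ _ _ (e₁ h).symm h')
    by_cases hPN : P ∈ HMPParam.law n ''
        {Θ : HMPParam d ℝ | Θ.Normalized ∧ Θ.coords ∈ degenerateSet d}
    · exact ⟨.cannotDecide, fun P' h => ⟨fun h' => absurd h' (hout h), fun _ =>
        ⟨fun _ => rfl, fun h' => absurd (hL₂ _ _ (e₂ h) hPN) h'⟩⟩⟩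
    · exact ⟨.noHMP, fun P' h => ⟨fun h' => absurd h' (hout h), fun _ =>
        ⟨fun h' => absurd (hL₂ _ _ (e₂ h).symm h') hPN, fun _ => rfl⟩⟩⟩
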